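/- **Setting.** All groups are finite and all representations are finite-dimensional and complex. $\operatorname{VRep}(W)$ denotes the ring of virtual representations of a finite group $W$ (equivalently, the ring of its virtual characters), and $\tau_W$, the unit of this ring, is the trivial representation. An *equivariant matroid* $W\curvearrowright M$ is a matroid $M$ without loops on a finite ground set $\mathcal I$, together with an action of a finite group $W$ on $\mathcal I$ that preserves $M$. Let $L$ be the lattice of flats of $M$, and write $\operatorname{rk}F$ for the rank of $F\in L$, $\operatorname{crk}F=\operatorname{rk}M-\operatorname{rk}F$, and $W_F\subset W$ for the stabilizer of $F$. Let $M_F$ be the matroid on the ground set $F$ whose flats are the flats of $M$ contained in $F$, and let $M^F$ be the matroid on $\mathcal I\smallsetminus F$ whose flats are the sets $G\smallsetminus F$ for the flats $G\supseteq F$ of $M$ (the contraction of $F$); $W_F$ acts on both. Let $OS^W_{M,p}$ be the representation of $W$ on the degree $p$ part of the Orlik–Solomon algebra of $M$, i.e. of the quotient of the exterior algebra over $\mathbb C$ on generators $e_i$ ($i\in\mathcal I$) by the ideal generated by the elements $\partial e_C$, for $C$ a circuit of $M$, where $w\in W$ acts by $e_i\mapsto e_{w(i)}$ and $\partial$ is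 the derivation with $\partial e_i=1$. Let $$H^W_M(t)=\sum_{p=0}^{\operatorname{rk}M}(-1)^p\,t^{\operatorname{rk}M-p}\,OS^W_{M,p}\in\operatorname{VRep}(W)[t].$$ **Statement.** There is a unique way to assign to each equivariant matroid $W\curvearrowright M$ an element $P^W_M(t)\in\operatorname{VRep}(W)[t]$ (the *equivariant Kazhdan–Lusztig polynomial*) such that 1. if $\operatorname{rk}M=0$, then $P^W_M(t)=\tau_W$; 2. if $\operatorname{rk}M>0$, then $\deg P^W_M(t)<\tfrac12\operatorname{rk}M$; 3. for every $W\curvearrowright M$, $\;t^{\operatorname{rk}M}P^W_M(t^{-1})=\sum_{[F]\in L/W}\operatorname{Ind}_{W_F}^W\!\left(H^{W_F}_{M_F}(t)\otimes P^{W_F}_{M^F}(t)\right)$, for every choice of representatives $F$ of the orbits $[F]\in L/W$; 4. for every homomorphism $\varphi:W'\to W$ of finite groups, $P^{W'}_M(t)=\varphi^*P^W_M(t)$, where $W'$ acts on $M$ through $\varphi$. Moreover, for every equivariant matroid $W\curvearrowright M$, the coefficients $C^W_{M,0}$ of $t^0$ and $C^W_{M,1}$ of $t^1$ in $P^W_M(t)$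 are $$C^W_{M,0}=\tau_W\qquad\text{and}\qquad C^W_{M,1}=\sum_{\substack{[F]\in L/W\\ \operatorname{crk}F=1}}\operatorname{Ind}_{W_F}^W(\tau_{W_F})\;-\;OS^W_{M,1}.$$ -/

import Mathlib

open scoped Matroid Polynomial

universe u v

noncomputable section

namespace EquivariantKL

/-! ### Virtual representations

`VRep W` is the ring of virtual complex representations of `W`, in the form of the ring of
virtual characters: the additive group of functions on `W` generated by the characters of
finite-dimensional complex representations.  (For a finite group a representation is determined
up to isomorphism by its character, direct sums and tensor products of representations become
sums and products of characters.) -/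

section VirtualRepresentations

variable {W : Type u} [Group W] {W' : Type u} [Group W']

/-- The set of characters of finite-dimensional complex representations of `W`. -/
def characters (W : Type u) [Group W] : Set (W → ℂ) :=
  {f | ∃ (n : ℕ) (ρ : Representation ℂ W (Fin n → ℂ)), f = ρ.character}

/-- The space `Fin n → ℂ` in the definition of `characters` is no restriction. -/
theorem character_mem {V : Type*} [AddCommGroup V] [Module ℂ V] [FiniteDimensional ℂ V]
    (ρ : Representation ℂ W V) : ρ.character ∈ characters W := by
  let e : V ≃ₗ[ℂ] (Fin (Module.finrank ℂ V) → ℂ) := (Module.finBasis ℂ V).equivFun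
  refine ⟨Module.finrank ℂ V,
    { toFun := fun w => e.conj (ρ w)
      map_one' := by rw [map_one]; exact e.conj_id
      map_mul' := fun a b => by rw [map_mul]; exact e.conj_comp (ρ b) (ρ a) }, ?_⟩
  funext w
  exact (LinearMap.trace_conj' (ρ w) e).symm

theorem one_mem_characters : (1 : W → ℂ) ∈ characters W := by
  have h := character_mem (Representation.trivial ℂ W ℂ)
  convert h using 1
  funext w
  simp [Representation.character, Representation.trivial]

theorem mul_mem_characters {f g : W → ℂ} (hf : f ∈ characters W) (hg : g ∈ characters W) :
    f * g ∈ characters W := by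
  obtain ⟨n, ρ, rfl⟩ := hf
  obtain ⟨m, σ, rfl⟩ := hg
  rw [← Representation.char_tensor]
  exact character_mem _

/-- The ring of virtual representations (virtual characters) of `W`; addition is direct sum,
multiplication is tensor product, `1` is the trivial representation. -/
def VRep (W : Type u) [Group W] : Subring (W → ℂ) where
  carrier := AddSubgroup.closure (characters W)
  add_mem' := AddSubgroup.add_mem _
  zero_mem' := AddSubgroup.zero_mem _
  neg_mem' := AddSubgroup.neg_mem _
  one_mem' := AddSubgroup.subset_closure one_mem_characters
  mul_mem' := by
    intro a b ha hb
    refine AddSubgroup.closure_induction₂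
      (p := fun x y _ _ => x * y ∈ AddSubgroup.closure (characters W)) ?_ ?_ ?_ ?_ ?_ ?_ ?_ ha hb
    · intro x y hx hy
      exact AddSubgroup.subset_closure (mul_mem_characters hx hy)
    · intro x _; simp
    · intro x _; simp
    · intro x y z _ _ _ h1 h2; rw [add_mul]; exact AddSubgroup.add_mem _ h1 h2
    · intro x y z _ _ _ h1 h2; rw [mul_add]; exact AddSubgroup.add_mem _ h1 h2
    · intro x y _ _ h; rw [neg_mul]; exact AddSubgroup.neg_mem _ h
    · intro x y _ _ h; rw [mul_neg]; exact AddSubgroup.neg_mem _ h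

theorem mem_VRep {f : W → ℂ} : f ∈ VRep W ↔ f ∈ AddSubgroup.closure (characters W) := Iff.rfl

/-- The class in `VRep W` of a finite-dimensional complex representation. -/
def classOf {V : Type*} [AddCommGroup V] [Module ℂ V] [FiniteDimensional ℂ V]
    (ρ : Representation ℂ W V) : VRep W :=
  ⟨ρ.character, AddSubgroup.subset_closure (character_mem ρ)⟩

/-- Pull-back of virtual representations along a group homomorphism `φ : W' → W`. -/
def res (φ : W' →* W) : VRep W →+* VRep W' where
  toFun f := ⟨fun w => (f : W → ℂ) (φ w), by
    have h : ∀ g ∈ AddSubgroup.closure (characters W),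
        (fun w => g (φ w)) ∈ AddSubgroup.closure (characters W') := by
      intro g hg
      induction hg using AddSubgroup.closure_induction with
      | mem x hx =>
        obtain ⟨n, ρ, rfl⟩ := hx
        exact AddSubgroup.subset_closure ⟨n, ρ.comp φ, rfl⟩
      | zero => exact AddSubgroup.zero_mem _
      | add x y _ _ hx hy => exact AddSubgroup.add_mem _ hx hy
      | neg x _ hx => exact AddSubgroup.neg_mem _ hx
    exact h _ f.2⟩
  map_one' := rfl
  map_mul' _ _ := rfl
  map_zero' := rfl
  map_add' _ _ := rfl

open scoped Classical in
/-- The class function on `W` induced from a function on a subgroup `H`: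
`w ↦ |H|⁻¹ ∑_{g ∈ W, g⁻¹ w g ∈ H} f (g⁻¹ w g)`. -/
def indFun [Finite W] (H : Subgroup W) (f : H → ℂ) (w : W) : ℂ :=
  (Nat.card H : ℂ)⁻¹ * ∑ᶠ g : W, if h : g⁻¹ * w * g ∈ H then f ⟨g⁻¹ * w * g, h⟩ else 0

theorem indFun_zero [Finite W] (H : Subgroup W) : indFun H 0 = 0 := by
  funext w
  simp [indFun]

theorem indFun_add [Finite W] (H : Subgroup W) (f g : H → ℂ) :
    indFun H (f + g) = indFun H f + indFun H g := by
  funext w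
  have := Fintype.ofFinite W
  simp only [indFun, finsum_eq_sum_of_fintype, Pi.add_apply]
  rw [← mul_add, ← Finset.sum_add_distrib]
  congr 1
  refine Finset.sum_congr rfl fun x _ => ?_
  split_ifs <;> simp

open scoped Classical in
/-- The matrices of a representation of `H`, extended by zero to `W`. -/
def extendZero (H : Subgroup W) {n : ℕ} (ρ : Representation ℂ H (Fin n → ℂ)) (g : W) :
    Matrix (Fin n) (Fin n) ℂ :=
  if h : g ∈ H then LinearMap.toMatrix' (ρ ⟨g, h⟩) else 0

section
variable (H : Subgroup W) {n : ℕ} (ρ : Representation ℂ H (Fin n → ℂ))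

theorem extendZero_mul {a b : W} (hb : b ∈ H) :
    extendZero H ρ a * extendZero H ρ b = extendZero H ρ (a * b) := by
  unfold extendZero
  by_cases ha : a ∈ H
  · rw [dif_pos ha, dif_pos hb, dif_pos (H.mul_mem ha hb), ← LinearMap.toMatrix'_mul, ← map_mul]
    rfl
  · have : a * b ∉ H := fun h => ha ((H.mul_mem_cancel_right hb).1 h)
    rw [dif_neg ha, dif_neg this, zero_mul]

theorem extendZero_one : extendZero H ρ 1 = 1 := by
  unfold extendZero
  rw [dif_pos H.one_mem]
  have : (⟨1, H.one_mem⟩ : H) = 1 := rfl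
  rw [this, map_one]
  exact LinearMap.toMatrix'_one

theorem extendZero_of_notMem {a : W} (ha : a ∉ H) : extendZero H ρ a = 0 := dif_neg ha

theorem out_inv_mul_out_mem_iff (x y : W ⧸ H) : x.out⁻¹ * y.out ∈ H ↔ x = y := by
  rw [← QuotientGroup.eq, QuotientGroup.out_eq', QuotientGroup.out_eq']

theorem bijective_out_mul : Function.Bijective fun p : (W ⧸ H) × H => p.1.out * (p.2 : W) := by
  constructor
  · rintro ⟨x, h⟩ ⟨y, k⟩ e
    have e' : x.out * (h : W) = y.out * (k : W) := e
    have hx : x = y := by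
      rw [← QuotientGroup.out_eq' x, ← QuotientGroup.out_eq' y,
        ← QuotientGroup.mk_mul_of_mem x.out h.2, ← QuotientGroup.mk_mul_of_mem y.out k.2, e']
    subst hx
    exact Prod.ext rfl (Subtype.ext (mul_left_cancel e'))
  · intro w
    refine ⟨((w : W ⧸ H), ⟨(w : W ⧸ H).out⁻¹ * w, ?_⟩), mul_inv_cancel_left _ _⟩
    rw [← QuotientGroup.eq, QuotientGroup.out_eq']

/-- The matrices of the induced representation, in blocks indexed by cosets. -/
def indMatrix (w : W) : Matrix ((W ⧸ H) × Fin n) ((W ⧸ H) × Fin n) ℂ :=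
  fun p q => extendZero H ρ (p.1.out⁻¹ * w * q.1.out) p.2 q.2

open scoped Classical in
theorem indMatrix_one : indMatrix H ρ 1 = 1 := by
  ext ⟨x, i⟩ ⟨y, j⟩
  simp only [indMatrix, mul_one]
  by_cases hxy : x = y
  · subst hxy
    rw [inv_mul_cancel, extendZero_one]
    simp [Matrix.one_apply]
  · rw [extendZero_of_notMem H ρ (mt (out_inv_mul_out_mem_iff H x y).1 hxy)]
    simp [hxy]

open scoped Classical in
theorem indMatrix_mul [Fintype (W ⧸ H)] (w w' : W) :
    indMatrix H ρ (w * w') = indMatrix H ρ w * indMatrix H ρ w' := by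
  ext ⟨x, i⟩ ⟨z, k⟩
  rw [Matrix.mul_apply, Fintype.sum_prod_type]
  have key : ∀ y : W ⧸ H, ∑ j, indMatrix H ρ w (x, i) (y, j) * indMatrix H ρ w' (y, j) (z, k) =
      if y = ((w' * z.out : W) : W ⧸ H) then indMatrix H ρ (w * w') (x, i) (z, k) else 0 := by
    intro y
    change ∑ j, extendZero H ρ (x.out⁻¹ * w * y.out) i j *
      extendZero H ρ (y.out⁻¹ * w' * z.out) j k = _
    rw [← Matrix.mul_apply]
    have hm : y.out⁻¹ * w' * z.out ∈ H ↔ y = ((w' * z.out : W) : W ⧸ H) := by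
      rw [mul_assoc, ← QuotientGroup.eq, QuotientGroup.out_eq']
    split_ifs with hy
    · rw [extendZero_mul H ρ (hm.2 hy)]
      have e : x.out⁻¹ * w * y.out * (y.out⁻¹ * w' * z.out) = x.out⁻¹ * (w * w') * z.out := by
        group
      rw [e]
      rfl
    · rw [extendZero_of_notMem H ρ (mt hm.1 hy), mul_zero]
      rfl
  rw [Finset.sum_congr rfl fun y _ => key y, Finset.sum_ite_eq' Finset.univ]
  simp

open scoped Classical in
/-- The representation of `W` induced from the representation `ρ` of `H`. -/
def indRep [Fintype (W ⧸ H)] : Representation ℂ W (((W ⧸ H) × Fin n) → ℂ) where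
  toFun w := Matrix.toLin' (indMatrix H ρ w)
  map_one' := by rw [indMatrix_one, Matrix.toLin'_one]; rfl
  map_mul' w w' := by rw [indMatrix_mul, Matrix.toLin'_mul]; rfl

open scoped Classical in
/-- `indFun` is induction: it takes the character of a representation of `H` to the character of
the induced representation. -/
theorem indFun_character [Finite W] [Fintype (W ⧸ H)] :
    indFun H ρ.character = (indRep H ρ).character := by
  funext w
  have := Fintype.ofFinite W
  have h1 : (indRep H ρ).character w =
      ∑ x : W ⧸ H, (extendZero H ρ (x.out⁻¹ * w * x.out)).trace := by
    change LinearMap.trace ℂ _ (Matrix.toLin' (indMatrix H ρ w)) = _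
    rw [Matrix.trace_toLin'_eq, Matrix.trace, Fintype.sum_prod_type]
    rfl
  have h2 : ∀ g : W, (if h : g⁻¹ * w * g ∈ H then ρ.character ⟨g⁻¹ * w * g, h⟩ else 0) =
      (extendZero H ρ (g⁻¹ * w * g)).trace := by
    intro g
    unfold extendZero
    split_ifs with h
    · exact LinearMap.trace_eq_matrix_trace ℂ (Pi.basisFun ℂ (Fin n)) _
    · exact (Matrix.trace_zero _ _).symm
  have h3 : ∀ (g : W) (h : H), (extendZero H ρ ((g * h)⁻¹ * w * (g * h))).trace =
      (extendZero H ρ (g⁻¹ * w * g)).trace := by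
    intro g h
    rw [← h2, ← h2]
    have e : (g * h)⁻¹ * w * (g * h) = (h : W)⁻¹ * (g⁻¹ * w * g) * h := by group
    by_cases hm : g⁻¹ * w * g ∈ H
    · have hm' : (g * h)⁻¹ * w * (g * h) ∈ H := by
        rw [e]; exact H.mul_mem (H.mul_mem (H.inv_mem h.2) hm) h.2
      rw [dif_pos hm, dif_pos hm']
      rw [← ρ.char_conj ⟨g⁻¹ * w * g, hm⟩ h⁻¹]
      congr 1
      ext
      change _ = (h : W)⁻¹ * (g⁻¹ * w * g) * ((h : W)⁻¹)⁻¹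
      rw [inv_inv]
      exact e
    · have hm' : (g * h)⁻¹ * w * (g * h) ∉ H := by
        rw [e]
        rw [H.mul_mem_cancel_right h.2, H.mul_mem_cancel_left (H.inv_mem h.2)]
        exact hm
      rw [dif_neg hm, dif_neg hm']
  unfold indFun
  rw [h1, finsum_eq_sum_of_fintype]
  simp_rw [h2]
  rw [← (Equiv.ofBijective _ (bijective_out_mul H)).sum_comp, Fintype.sum_prod_type]
  have h4 : ∀ x : W ⧸ H, ∑ h : H, (extendZero H ρ
      ((Equiv.ofBijective _ (bijective_out_mul H) (x, h))⁻¹ * w *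
        Equiv.ofBijective _ (bijective_out_mul H) (x, h))).trace =
      (Nat.card H : ℂ) * (extendZero H ρ (x.out⁻¹ * w * x.out)).trace := by
    intro x
    refine (Finset.sum_congr rfl fun h _ => h3 x.out h).trans ?_
    rw [Finset.sum_const, nsmul_eq_mul,
      Finset.card_univ, Nat.card_eq_fintype_card]
  rw [Finset.sum_congr rfl fun x _ => h4 x, ← Finset.mul_sum, ← mul_assoc, inv_mul_cancel₀,
    one_mul]
  exact Nat.cast_ne_zero.2 Nat.card_pos.ne'
end

/-- Induction `VRep H → VRep W` from a subgroup `H` of a finite group `W`. -/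
def ind [Finite W] (H : Subgroup W) : VRep H →+ VRep W where
  toFun f := ⟨indFun H f, by
    have h : ∀ g ∈ AddSubgroup.closure (characters H),
        indFun H g ∈ AddSubgroup.closure (characters W) := by
      intro g hg
      induction hg using AddSubgroup.closure_induction with
      | mem x hx =>
        obtain ⟨n, ρ, rfl⟩ := hx
        have := Fintype.ofFinite (W ⧸ H)
        rw [indFun_character]
        exact AddSubgroup.subset_closure (character_mem _)
      | zero => rw [indFun_zero]; exact AddSubgroup.zero_mem _
      | add x y _ _ hx hy => rw [indFun_add]; exact AddSubgroup.add_mem _ hx hy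
      | neg x _ hx =>
        have e : indFun H (-x) = -indFun H x := by
          rw [eq_neg_iff_add_eq_zero, ← indFun_add, neg_add_cancel, indFun_zero]
        rw [e]; exact AddSubgroup.neg_mem _ hx
    exact h _ f.2⟩
  map_zero' := Subtype.ext (indFun_zero H)
  map_add' f g := Subtype.ext (indFun_add H f g)

/-- Induction of graded virtual representations, coefficient by coefficient. -/
def indPoly [Finite W] (H : Subgroup W) (p : (VRep H)[X]) : (VRep W)[X] :=
  p.sum fun i a => Polynomial.monomial i (ind H a)

end VirtualRepresentations

/-! ### Equivariant matroids -/

/-- An equivariant matroid: a matroid `M` with finite ground set `M.E ⊆ α`, without loops, and an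
action of `W` on `α` that preserves `M` (in particular, it maps the ground set to itself). -/
structure EquivariantMatroid (W : Type u) [Group W] (α : Type v) where
  M : Matroid α
  finite : M.E.Finite
  loopless : M.Loopless
  act : W →* Equiv.Perm α
  preserves : ∀ w, M.mapEquiv (act w) = M

namespace EquivariantMatroid

section

variable {W : Type u} [Group W] {W' : Type u} [Group W'] {α : Type v}
variable (X : EquivariantMatroid W α)

instance : Finite X.M.E := X.finite

theorem indep_image (w : W) (I : Set α) : X.M.Indep (X.act w '' I) ↔ X.M.Indep I := by
  conv_lhs => rw [← X.preserves w]
  rw [Matroid.mapEquiv_indep_iff, Equiv.symm_image_image]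

theorem dep_image (w : W) (I : Set α) : X.M.Dep (X.act w '' I) ↔ X.M.Dep I := by
  conv_lhs => rw [← X.preserves w]
  rw [Matroid.mapEquiv_dep_iff, Equiv.symm_image_image]

theorem isFlat_image (w : W) {F : Set α} (hF : X.M.IsFlat F) : X.M.IsFlat (X.act w '' F) := by
  rw [Matroid.isFlat_iff_closure_eq] at hF ⊢
  conv_lhs => rw [← X.preserves w]
  rw [Matroid.mapEquiv_eq_map, Matroid.map_closure_eq, Set.preimage_image_eq _ (X.act w).injective,
    hF]

theorem image_ground (w : W) : X.act w '' X.M.E = X.M.E := by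
  conv_rhs => rw [← X.preserves w]
  rw [Matroid.mapEquiv_ground_eq]

theorem act_mem_ground (w : W) {a : α} (ha : a ∈ X.M.E) : X.act w a ∈ X.M.E := by
  rw [← X.image_ground w]
  exact Set.mem_image_of_mem _ ha

theorem isCircuit_image (w : W) {C : Set α} (hC : X.M.IsCircuit C) :
    X.M.IsCircuit (X.act w '' C) := by
  rw [Matroid.isCircuit_iff] at hC ⊢
  refine ⟨(X.dep_image w C).2 hC.1, fun D hD hDC => ?_⟩
  obtain ⟨D', rfl⟩ : ∃ D', X.act w '' D' = D := ⟨(X.act w).symm '' D, by simp⟩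
  rw [hC.2 ((X.dep_image w D').1 hD) ((Set.image_subset_image_iff (X.act w).injective).1 hDC)]

/-- The action of `W` on the ground set. -/
def groundPerm : W →* Equiv.Perm X.M.E where
  toFun w := (X.act w).subtypePerm fun a => by
    constructor
    · intro h
      simpa [← Equiv.Perm.mul_apply, ← map_mul] using X.act_mem_ground w⁻¹ h
    · exact X.act_mem_ground w
  map_one' := by ext a; simp
  map_mul' a b := by
    ext x
    change X.act (a * b) x = X.act a (X.act b x)
    rw [map_mul]
    rfl

end

end EquivariantMatroid

/-! ### The Orlik–Solomon algebra -/

section OrlikSolomon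

variable {α : Type v}

/-- The exterior algebra over `ℂ` on generators `e_i`, one for each `i` in the ground set. -/
abbrev Ext (M : Matroid α) : Type v := ExteriorAlgebra ℂ (M.E →₀ ℂ)

/-- The monomial `e_{i₁} ⋯ e_{i_r}`. -/
def extMonomial (M : Matroid α) (l : List M.E) : Ext M :=
  (l.map fun i => ExteriorAlgebra.ι ℂ (Finsupp.single i (1 : ℂ))).prod

/-- The derivation `∂` of the exterior algebra with `∂ e_i = 1` for all `i`, that is
`∂ (e_{i₁} ⋯ e_{i_r}) = ∑ₖ (-1)^(k-1) e_{i₁} ⋯ ê_{iₖ} ⋯ e_{i_r}`. -/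
def boundary (M : Matroid α) : Ext M →ₗ[ℂ] Ext M :=
  CliffordAlgebra.contractLeft (Finsupp.lsum ℂ fun _ : M.E => (LinearMap.id : ℂ →ₗ[ℂ] ℂ))

/-- The elements `∂ e_C`, for `C` a circuit of `M` (listed in any order, without repetition). -/
def circuitBoundaries (M : Matroid α) : Set (Ext M) :=
  {x | ∃ l : List M.E, l.Nodup ∧ M.IsCircuit {a | ∃ i ∈ l, (i : α) = a} ∧
    x = boundary M (extMonomial M l)}

/-- The Orlik–Solomon ideal: the two-sided ideal generated by the `∂ e_C`. -/
def osIdeal (M : Matroid α) : Ideal (Ext M) :=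
  (TwoSidedIdeal.span (circuitBoundaries M)).asIdeal

instance (M : Matroid α) : (osIdeal M).IsTwoSided := by
  unfold osIdeal; infer_instance

/-- The (complex) Orlik–Solomon algebra of `M`. -/
abbrev OSAlgebra (M : Matroid α) : Type v := Ext M ⧸ osIdeal M

/-- The degree `p` part of the Orlik–Solomon algebra: the image of the `p`-th exterior power. -/
def osDegree (M : Matroid α) (p : ℕ) : Submodule ℂ (OSAlgebra M) :=
  (⋀[ℂ]^p (M.E →₀ ℂ)).map (Ideal.Quotient.mkₐ ℂ (osIdeal M)).toLinearMap

end OrlikSolomon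

namespace EquivariantMatroid

section

variable {W : Type u} [Group W] {W' : Type u} [Group W'] {α : Type v}
variable (X : EquivariantMatroid W α)

instance (p : ℕ) : FiniteDimensional ℂ (osDegree X.M p) := by
  unfold osDegree
  infer_instance

/-- The action of `W` on the exterior algebra, `w e_i = e_{w i}`. -/
def extAct (w : W) : Ext X.M →ₐ[ℂ] Ext X.M :=
  ExteriorAlgebra.map (Finsupp.lmapDomain ℂ ℂ (X.groundPerm w))

theorem extAct_one : X.extAct 1 = AlgHom.id ℂ _ := by
  unfold extAct
  rw [map_one]
  convert! ExteriorAlgebra.map_id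
  exact Finsupp.lmapDomain_id ℂ ℂ

theorem extAct_mul (w w' : W) : X.extAct (w * w') = (X.extAct w).comp (X.extAct w') := by
  unfold extAct
  rw [ExteriorAlgebra.map_comp_map, map_mul, Equiv.Perm.coe_mul, Finsupp.lmapDomain_comp]

theorem extAct_monomial (w : W) (l : List X.M.E) :
    X.extAct w (extMonomial X.M l) = extMonomial X.M (l.map (X.groundPerm w)) := by
  unfold extAct extMonomial
  rw [map_list_prod, List.map_map, List.map_map]
  congr 1
  refine List.map_congr_left fun i _ => ?_
  simp

theorem sum_lmapDomain {ι : Type*} (σ : ι → ι) (m : ι →₀ ℂ) :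
    (Finsupp.lsum ℂ fun _ : ι => (LinearMap.id : ℂ →ₗ[ℂ] ℂ)) (Finsupp.lmapDomain ℂ ℂ σ m) =
      (Finsupp.lsum ℂ fun _ : ι => (LinearMap.id : ℂ →ₗ[ℂ] ℂ)) m := by
  induction m using Finsupp.induction_linear with
  | zero => simp
  | add f g hf hg => rw [map_add, map_add, map_add, hf, hg]
  | single i c => simp

theorem extAct_boundary (w : W) (x : Ext X.M) :
    X.extAct w (boundary X.M x) = boundary X.M (X.extAct w x) := by
  unfold boundary
  induction x using CliffordAlgebra.left_induction with
  | algebraMap r =>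
    have hc : X.extAct w (algebraMap ℂ (CliffordAlgebra 0) r) =
        algebraMap ℂ (CliffordAlgebra 0) r := (X.extAct w).commutes r
    rw [hc, CliffordAlgebra.contractLeft_algebraMap]
    exact map_zero (X.extAct w)
  | add x y hx hy => rw [map_add, map_add, map_add, map_add, hx, hy]
  | ι_mul x m hx =>
    have hι : X.extAct w (CliffordAlgebra.ι 0 m) =
        CliffordAlgebra.ι 0 (Finsupp.lmapDomain ℂ ℂ (X.groundPerm w) m) :=
      ExteriorAlgebra.map_apply_ι _ _
    have hd := sum_lmapDomain (X.groundPerm w) m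
    rw [CliffordAlgebra.contractLeft_ι_mul, map_sub, map_smul, map_mul, map_mul, hι,
      CliffordAlgebra.contractLeft_ι_mul, hd, hx]

theorem extAct_mem_osIdeal (w : W) {x : Ext X.M} (hx : x ∈ osIdeal X.M) :
    X.extAct w x ∈ osIdeal X.M := by
  have h : TwoSidedIdeal.span (circuitBoundaries X.M) ≤
      (TwoSidedIdeal.span (circuitBoundaries X.M)).comap (X.extAct w) := by
    rw [TwoSidedIdeal.span_le]
    rintro _ ⟨l, hl, hC, rfl⟩
    rw [SetLike.mem_coe, TwoSidedIdeal.mem_comap, extAct_boundary, extAct_monomial]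
    refine TwoSidedIdeal.subset_span ⟨_, hl.map (X.groundPerm w).injective, ?_, rfl⟩
    convert X.isCircuit_image w hC using 1
    ext a
    simp only [List.mem_map, Set.mem_ofPred_eq, Set.mem_image]
    constructor
    · rintro ⟨_, ⟨i, hi, rfl⟩, rfl⟩
      exact ⟨i, ⟨i, hi, rfl⟩, rfl⟩
    · rintro ⟨_, ⟨i, hi, rfl⟩, rfl⟩
      exact ⟨_, ⟨i, hi, rfl⟩, rfl⟩
  exact TwoSidedIdeal.mem_asIdeal.2
    ((TwoSidedIdeal.mem_comap (X.extAct w)).1 (h (TwoSidedIdeal.mem_asIdeal.1 hx)))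

/-- The action of `W` on the Orlik–Solomon algebra by algebra endomorphisms. -/
def osAct (w : W) : OSAlgebra X.M →ₐ[ℂ] OSAlgebra X.M :=
  Ideal.quotientMapₐ (osIdeal X.M) (X.extAct w) fun _ hx => X.extAct_mem_osIdeal w hx

theorem osAct_mem_osDegree (w : W) (p : ℕ) {x : OSAlgebra X.M} (hx : x ∈ osDegree X.M p) :
    X.osAct w x ∈ osDegree X.M p := by
  obtain ⟨y, hy, rfl⟩ := hx
  refine ⟨X.extAct w y, ?_, rfl⟩
  rw [SetLike.mem_coe, ← ExteriorAlgebra.ιMulti_span_fixedDegree] at hy ⊢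
  induction hy using Submodule.span_induction with
  | mem z hz =>
    obtain ⟨v, rfl⟩ := hz
    unfold extAct
    rw [ExteriorAlgebra.map_apply_ιMulti]
    exact Submodule.subset_span ⟨_, rfl⟩
  | zero => rw [map_zero]; exact Submodule.zero_mem _
  | add x y _ _ hx hy => rw [map_add]; exact Submodule.add_mem _ hx hy
  | smul c x _ hx => rw [map_smul]; exact Submodule.smul_mem _ c hx

theorem osAct_one : X.osAct 1 = AlgHom.id ℂ _ := by
  ext x
  obtain ⟨y, rfl⟩ := Ideal.Quotient.mk_surjective x
  change Ideal.Quotient.mk _ (X.extAct 1 y) = Ideal.Quotient.mk _ y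
  rw [extAct_one, AlgHom.id_apply]

theorem osAct_mul (w w' : W) : X.osAct (w * w') = (X.osAct w).comp (X.osAct w') := by
  ext x
  obtain ⟨y, rfl⟩ := Ideal.Quotient.mk_surjective x
  change Ideal.Quotient.mk _ (X.extAct (w * w') y) =
    Ideal.Quotient.mk _ (X.extAct w (X.extAct w' y))
  rw [extAct_mul, AlgHom.comp_apply]

/-- The representation of `W` on the degree `p` part of the Orlik–Solomon algebra. -/
def osRep (p : ℕ) : Representation ℂ W (osDegree X.M p) where
  toFun w := (X.osAct w).toLinearMap.restrict fun _ hx => X.osAct_mem_osDegree w p hx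
  map_one' := by
    ext x
    change X.osAct 1 x = x
    rw [osAct_one, AlgHom.id_apply]
  map_mul' a b := by
    ext x
    change X.osAct (a * b) x = X.osAct a (X.osAct b x)
    rw [osAct_mul, AlgHom.comp_apply]

/-- The class of the degree `p` part of the Orlik–Solomon algebra in `VRep W`. -/
def osClass (p : ℕ) : VRep W := classOf (X.osRep p)

/-- The rank of the underlying matroid (it is finite). -/
def rank : ℕ := X.M.eRank.toNat

/-- The equivariant characteristic polynomial `∑ₚ (-1)^p t^(rk M - p) OS_p`. -/
def charPoly : (VRep W)[X] :=
  ∑ p ∈ Finset.range (X.rank + 1),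
    Polynomial.C ((-1) ^ p * X.osClass p) * Polynomial.X ^ (X.rank - p)

/-! ### Flats, localization and restriction -/

/-- The flats of the underlying matroid. -/
def Flat : Type v := {F : Set α // X.M.IsFlat F}

instance : Finite X.Flat :=
  (X.finite.finite_subsets.subset fun _ hF => hF.subset_ground : {F | X.M.IsFlat F}.Finite)

/-- The action of `W` on the set of flats. -/
instance : MulAction W X.Flat where
  smul w F := ⟨X.act w '' F.1, X.isFlat_image w F.2⟩
  one_smul F := Subtype.ext <| by
    change X.act 1 '' F.1 = F.1
    simp
  mul_smul a b F := Subtype.ext <| by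
    change X.act (a * b) '' F.1 = X.act a '' (X.act b '' F.1)
    rw [map_mul, Equiv.Perm.coe_mul, Set.image_comp]

/-- The stabilizer `W_F` of a flat. -/
abbrev stab (F : X.Flat) : Subgroup W := MulAction.stabilizer W F

/-- The set `L/W` of orbits of flats. -/
abbrev FlatOrbit : Type v := MulAction.orbitRel.Quotient W X.Flat

instance : Fintype X.FlatOrbit := Fintype.ofFinite _

/-- `rep` chooses a representative in each orbit of flats. -/
def IsRepChoice (rep : X.FlatOrbit → X.Flat) : Prop :=
  ∀ o, (Quotient.mk _ (rep o) : X.FlatOrbit) = o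

/-- The rank of a flat. -/
def flatRank (F : X.Flat) : ℕ := (X.M.eRk F.1).toNat

theorem mapEquiv_restrict {M : Matroid α} {σ : Equiv.Perm α} (h : M.mapEquiv σ = M) {R : Set α}
    (hR : σ '' R = R) : (M ↾ R).mapEquiv σ = M ↾ R := by
  have hR' : σ.symm '' R = R := by
    conv_lhs => rw [← hR]
    exact Equiv.symm_image_image σ R
  refine Matroid.ext_indep (by rw [Matroid.mapEquiv_ground_eq]; exact hR) fun I _ => ?_
  rw [Matroid.mapEquiv_indep_iff, Matroid.restrict_indep_iff, Matroid.restrict_indep_iff,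
    ← Matroid.mapEquiv_indep_iff, h]
  conv_lhs => rw [← hR', Set.image_subset_image_iff σ.symm.injective]

theorem mapEquiv_dual {M : Matroid α} {σ : Equiv.Perm α} (h : M.mapEquiv σ = M) :
    M✶.mapEquiv σ = M✶ := by
  conv_rhs => rw [← h, Matroid.mapEquiv_eq_map, Matroid.map_dual]
  rw [Matroid.mapEquiv_eq_map]

theorem mapEquiv_contract {M : Matroid α} {σ : Equiv.Perm α} (h : M.mapEquiv σ = M) {F : Set α}
    (hF : σ '' F = F) : (M ／ F).mapEquiv σ = M ／ F := by
  have hE : σ '' M.E = M.E := by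
    conv_rhs => rw [← h]
    rw [Matroid.mapEquiv_ground_eq]
  have hD : σ '' (M.E \ F) = M.E \ F := by
    rw [Set.image_sdiff σ.injective, hE, hF]
  exact mapEquiv_dual (mapEquiv_restrict (mapEquiv_dual h) hD)

theorem stab_image (F : X.Flat) (w : X.stab F) : X.act w '' F.1 = F.1 :=
  congrArg Subtype.val (show (w : W) • F = F from w.2)

/-- The localization at a flat `F`: the matroid on the ground set `F` whose flats are the flats of
`M` contained in `F`, with the action of the stabilizer of `F`. -/
def localize (F : X.Flat) : EquivariantMatroid (X.stab F) α where
  M := X.M ↾ F.1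
  finite := X.finite.subset F.2.subset_ground
  loopless := by
    have := X.loopless
    exact (Matroid.restrict_isRestriction X.M F.1 F.2.subset_ground).loopless
  act := X.act.comp (X.stab F).subtype
  preserves w := mapEquiv_restrict (X.preserves w) (X.stab_image F w)

/-- The restriction at a flat `F`: the matroid on the complement of `F` whose flats
correspond to the flats of `M` containing `F` (this is the contraction of `F` in `M`), with the
action of the stabilizer of `F`. -/
def contract (F : X.Flat) : EquivariantMatroid (X.stab F) α where
  M := X.M ／ F.1
  finite := X.finite.subset Set.sdiff_subset
  loopless := by
    rw [Matroid.loopless_iff_forall_not_isLoop]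
    intro e _ he
    rw [Matroid.contract_isLoop_iff_mem_closure, F.2.closure] at he
    exact he.2 he.1
  act := X.act.comp (X.stab F).subtype
  preserves w := mapEquiv_contract (X.preserves w) (X.stab_image F w)

/-- Pull-back of an equivariant matroid along a group homomorphism `φ : W' → W`. -/
def pullback (φ : W' →* W) : EquivariantMatroid W' α where
  M := X.M
  finite := X.finite
  loopless := X.loopless
  act := X.act.comp φ
  preserves w := X.preserves (φ w)

end

end EquivariantMatroid

/-! ### The equivariant Kazhdan–Lusztig polynomial -/

/-- An assignment of an element of `grVRep(W) = VRep(W)[t]` to each equivariant matroid. -/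
def Assignment : Type (max (u + 1) (v + 1)) :=
  ∀ (W : Type u) [Group W] [Finite W] (α : Type v), EquivariantMatroid W α → (VRep W)[X]

/-- The conditions that characterize the assignment `P` of the equivariant Kazhdan–Lusztig
polynomial to every equivariant matroid. -/
structure IsEquivariantKL (P : Assignment.{u, v}) : Prop where
  /-- In rank `0`, `P` is the trivial representation in degree `0`. -/
  rank_zero : ∀ (W : Type u) [Group W] [Finite W] (α : Type v) (X : EquivariantMatroid W α),
    X.rank = 0 → P W α X = 1
  /-- In positive rank, `deg P < rk M / 2`. -/
  degree_lt : ∀ (W : Type u) [Group W] [Finite W] (α : Type v) (X : EquivariantMatroid W α),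
    0 < X.rank → 2 * (P W α X).natDegree < X.rank
  /-- `t^(rk M) P_M(t⁻¹) = ∑_{[F] ∈ L/W} Ind (H_{M_F}(t) ⊗ P_{M^F}(t))`, whatever the choice of
  representatives of the orbits.  In view of the bounds on the degree, `Polynomial.reflect` by
  `rk M` is the operation `p(t) ↦ t^(rk M) p(t⁻¹)`. -/
  recursion : ∀ (W : Type u) [Group W] [Finite W] (α : Type v) (X : EquivariantMatroid W α)
    (rep : X.FlatOrbit → X.Flat), X.IsRepChoice rep →
    (P W α X).reflect X.rank = ∑ o : X.FlatOrbit, indPoly (X.stab (rep o))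
      ((X.localize (rep o)).charPoly * P (X.stab (rep o)) α (X.contract (rep o)))
  /-- Compatibility with pull-back along group homomorphisms `φ : W' → W`. -/
  pullback : ∀ (W W' : Type u) [Group W] [Finite W] [Group W'] [Finite W'] (φ : W' →* W)
    (α : Type v) (X : EquivariantMatroid W α),
    P W' α (X.pullback φ) = (P W α X).map (res φ)

end EquivariantKL

end

/-! A virtual character is a function on `W`, so every identity can be tested at one element `w`. By
the formula for induced characters, the value at `w` of a sum over orbits of flats of inductions
from stabilizers is a plain sum over the flats fixed by `w` (`sum_indFun`, `ev_sum_indPoly`). The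
recursion thus becomes a Kazhdan–Lusztig–Stanley recursion on the lattice of flats fixed by `w`,
with ranks taken in `M`.

Its kernel, the value of `H` at `w`, is the characteristic polynomial `cp` of that lattice
(`ev_charPoly`). Indeed, the degree `p` part of the Orlik–Solomon algebra is the direct sum, over
the flats of rank `p`, of the top degree parts of the localizations (Brieskorn's decomposition).
Since `w` permutes the summands, only fixed flats contribute to its trace (`osTrace_eq_sum`). On the
other hand `∂` commutes with `W` and makes the algebra acyclic when the ground set is nonempty, so
the alternating sum of the traces vanishes (`sum_neg_one_pow_mul_osTrace`). Together these say that
the signed trace in top degree obeys the recursion of the Möbius numbers of the fixed lattice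
(`neg_one_pow_mul_osTrace_rank`).

Möbius inversion gives the kernel identity `sum_reflect_cp_mul_cp`. By induction it makes the
contribution `S` of the nonempty flats antisymmetric under `p(t) ↦ t^r p(t⁻¹)`, where `r` is the
rank (`reflect_klSum`). For `r > 0` the equation `t^r P(t⁻¹) = P + S` then has exactly one solution
of degree less than `r / 2`, namely minus the part of `S` below `r / 2` (`reflect_kl`,
`eq_kl_of_reflect`). This gives uniqueness. For existence, the same formula is carried out with
coefficients in `VRep W`, so that the polynomials found for the various `w` are values of one graded
virtual character (`exists_ev_eq_kl`).

The coefficients of `1` and `t` in `P` are read off in degrees `r` and `r - 1` of the recursion: the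
degree bounds leave only the full flat in the first case, and the full flat and the flats of corank
one in the second. -/

noncomputable section

namespace EquivariantKL

/-! ### Monomials in the Orlik–Solomon algebra -/

section Monomials

variable {α : Type v} {M N : Matroid α}

/-- The generator `e_i` of the exterior algebra. -/
abbrev extGen (M : Matroid α) (i : M.E) : Ext M := ExteriorAlgebra.ι ℂ (Finsupp.single i (1 : ℂ))

/-- The set of elements of a list of elements of the ground set. -/
def supp (l : List M.E) : Set α := {a | ∃ i ∈ l, (i : α) = a}

theorem mem_supp {l : List M.E} {a : α} : a ∈ supp l ↔ ∃ i ∈ l, (i : α) = a := Iff.rfl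

theorem coe_mem_supp {l : List M.E} {i : M.E} : (i : α) ∈ supp l ↔ i ∈ l :=
  ⟨fun ⟨_, hj, h⟩ => Subtype.ext h ▸ hj, fun h => ⟨i, h, rfl⟩⟩

theorem supp_subset_ground (l : List M.E) : supp l ⊆ M.E := by
  rintro _ ⟨i, _, rfl⟩
  exact i.2

theorem supp_eq_image (l : List M.E) : supp l = Subtype.val '' {i | i ∈ l} := by
  ext a
  simp [mem_supp]

theorem encard_supp {l : List M.E} (hl : l.Nodup) : (supp l).encard = l.length := by
  classical
  rw [supp_eq_image, Subtype.val_injective.encard_image]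
  have : {i | i ∈ l} = (l.toFinset : Set M.E) := by ext; simp
  rw [this, Set.encard_coe_eq_coe_finsetCard, List.toFinset_card_of_nodup hl]

@[simp] theorem extMonomial_nil : extMonomial M [] = 1 := rfl

theorem extMonomial_cons (i : M.E) (l : List M.E) :
    extMonomial M (i :: l) = extGen M i * extMonomial M l := by
  simp [extMonomial]

theorem extMonomial_append (l l' : List M.E) :
    extMonomial M (l ++ l') = extMonomial M l * extMonomial M l' := by
  simp [extMonomial]

theorem extGen_mul_self (i : M.E) : extGen M i * extGen M i = 0 := ExteriorAlgebra.ι_sq_zero _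

theorem boundary_one : boundary M 1 = 0 := CliffordAlgebra.contractLeft_one ..

theorem boundary_extGen_mul (i : M.E) (x : Ext M) :
    boundary M (extGen M i * x) = x - extGen M i * boundary M x := by
  refine (CliffordAlgebra.contractLeft_ι_mul _ _ _).trans ?_
  simp [boundary]

/-- The sign of the permutation is not recorded: only membership in submodules and vanishing are at
stake later. -/
theorem extMonomial_perm {l l' : List M.E} (h : l.Perm l') :
    extMonomial M l = extMonomial M l' ∨ extMonomial M l = -extMonomial M l' := by
  induction h with
  | nil => exact Or.inl rfl
  | cons i _ ih =>
    rw [extMonomial_cons, extMonomial_cons]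
    rcases ih with h | h <;> simp [h]
  | swap i j l =>
    right
    simp only [extMonomial_cons, ← mul_assoc]
    rw [eq_neg_of_add_eq_zero_left (ExteriorAlgebra.ι_add_mul_swap (Finsupp.single j (1 : ℂ))
      (Finsupp.single i (1 : ℂ))), neg_mul]
  | trans _ _ ih1 ih2 => rcases ih1 with h | h <;> rcases ih2 with h' | h' <;> simp [h, h']

theorem extMonomial_mem_iff_of_perm {l l' : List M.E} (h : l.Perm l') {S : Submodule ℂ (Ext M)} :
    extMonomial M l ∈ S ↔ extMonomial M l' ∈ S := by
  rcases extMonomial_perm h with h | h <;> simp [h]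

theorem extMonomial_eq_zero {l : List M.E} (hl : ¬ l.Nodup) : extMonomial M l = 0 := by
  rw [← List.exists_duplicate_iff_not_nodup] at hl
  obtain ⟨i, hi⟩ := hl
  obtain ⟨t, ht⟩ := (List.duplicate_iff_sublist.1 hi).exists_perm_append
  have h0 : extMonomial M ([i, i] ++ t) = 0 := by
    simp only [List.cons_append, List.nil_append, extMonomial_cons, ← mul_assoc, extGen_mul_self,
      zero_mul]
  rcases extMonomial_perm ht with h | h <;> rw [h, h0]
  exact neg_zero

/-- Since `e_i ^ 2 = 0`, only the first term of `∂ (e_i x) = x - e_i ∂ x` survives multiplication by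
`e_i`. Hence `e_C` itself lies in the ideal generated by `∂ e_C`. -/
theorem extGen_mul_boundary {l : List M.E} {i : M.E} :
    extGen M i * boundary M (extMonomial M (i :: l)) = extMonomial M (i :: l) := by
  rw [extMonomial_cons, boundary_extGen_mul, mul_sub, ← mul_assoc, extGen_mul_self, zero_mul,
    sub_zero]

theorem boundary_mem_osIdeal {l : List M.E} (hl : l.Nodup) (hC : M.IsCircuit (supp l)) :
    boundary M (extMonomial M l) ∈ osIdeal M :=
  TwoSidedIdeal.mem_asIdeal.2 (TwoSidedIdeal.subset_span ⟨l, hl, hC, rfl⟩)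

theorem extMonomial_mem_osIdeal_of_isCircuit {l : List M.E} (hl : l.Nodup)
    (hC : M.IsCircuit (supp l)) : extMonomial M l ∈ osIdeal M := by
  cases l with
  | nil =>
    have h := hC.nonempty
    obtain ⟨a, i, hi, _⟩ := h
    simp at hi
  | cons i t =>
    rw [← extGen_mul_boundary]
    exact Ideal.mul_mem_left _ _ (boundary_mem_osIdeal hl hC)

/-- The monomial of a dependent set vanishes in the Orlik–Solomon algebra. -/
theorem extMonomial_mem_osIdeal {l : List M.E} (h : ¬ (l.Nodup ∧ M.Indep (supp l))) :
    extMonomial M l ∈ osIdeal M := by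
  classical
  by_cases hl : l.Nodup
  · have hd : M.Dep (supp l) := ⟨fun hi => h ⟨hl, hi⟩, supp_subset_ground l⟩
    obtain ⟨C, hCs, hC⟩ := hd.exists_isCircuit_subset
    -- Moving the elements of the circuit `C` to the front makes the monomial, up to sign, a
    -- multiple of `e_C`.
    have hp := List.filter_append_perm (fun i : M.E => decide ((i : α) ∈ C)) l
    have hs : supp (l.filter fun i : M.E => decide ((i : α) ∈ C)) = C := by
      ext a
      simp only [mem_supp, List.mem_filter, decide_eq_true_eq]
      constructor
      · rintro ⟨i, ⟨_, hi⟩, rfl⟩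
        exact hi
      · intro ha
        obtain ⟨i, hi, rfl⟩ := hCs ha
        exact ⟨i, ⟨hi, ha⟩, rfl⟩
    have h1 := extMonomial_mem_iff_of_perm (S := (osIdeal M).restrictScalars ℂ) hp
    refine h1.1 ?_
    rw [extMonomial_append]
    refine Ideal.mul_mem_right _ _ (extMonomial_mem_osIdeal_of_isCircuit (hl.filter _) ?_)
    rwa [hs]
  · rw [extMonomial_eq_zero hl]
    exact Ideal.zero_mem _

/-! ### The graded Leibniz rule and stability of the Orlik–Solomon ideal under `∂`. -/

theorem boundary_mul (x y : Ext M) :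
    boundary M (x * y) = boundary M x * y + CliffordAlgebra.involute x * boundary M y := by
  induction x using CliffordAlgebra.left_induction with
  | algebraMap r =>
    have h : boundary M (algebraMap ℂ (CliffordAlgebra 0) r) = 0 :=
      CliffordAlgebra.contractLeft_algebraMap _ _ r
    rw [h, zero_mul, zero_add, AlgHom.commutes, ← Algebra.smul_def, ← Algebra.smul_def, map_smul]
  | add a b ha hb => simp only [add_mul, map_add, ha, hb]; abel
  | ι_mul x m hx =>
    have h : ∀ z, boundary M (CliffordAlgebra.ι 0 m * z) = _ :=
      fun z => CliffordAlgebra.contractLeft_ι_mul _ m z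
    rw [mul_assoc, h, h]
    change _ • (x * y) - _ * boundary M (x * y) = (_ • x - _ * boundary M x) * y + _
    rw [hx, map_mul, CliffordAlgebra.involute_ι, sub_mul, smul_mul_assoc, mul_add]
    simp only [neg_mul, mul_assoc]
    abel

theorem involute_extMonomial (l : List M.E) :
    CliffordAlgebra.involute (extMonomial M l) = (-1 : ℂ) ^ l.length • extMonomial M l := by
  induction l with
  | nil => simp
  | cons i l ih =>
    rw [extMonomial_cons, map_mul, ih, List.length_cons, pow_succ]
    have : CliffordAlgebra.involute (extGen M i) = -extGen M i := CliffordAlgebra.involute_ι _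
    rw [this]
    simp

theorem involute_boundary (x : Ext M) :
    CliffordAlgebra.involute (boundary M x) = -boundary M (CliffordAlgebra.involute x) := by
  induction x using CliffordAlgebra.left_induction with
  | algebraMap r =>
    have h : boundary M (algebraMap ℂ (CliffordAlgebra 0) r) = 0 :=
      CliffordAlgebra.contractLeft_algebraMap _ _ r
    rw [AlgHom.commutes, h, map_zero, neg_zero]
  | add a b ha hb => simp only [map_add, ha, hb]; abel
  | ι_mul x m hx =>
    have h : ∀ z, boundary M (CliffordAlgebra.ι 0 m * z) = _ :=
      fun z => CliffordAlgebra.contractLeft_ι_mul _ m z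
    change _ = - boundary M (CliffordAlgebra.involute x) at hx
    rw [h, map_mul, CliffordAlgebra.involute_ι, neg_mul, map_neg, h, map_sub, map_mul, map_smul,
      CliffordAlgebra.involute_ι]
    change _ - _ * CliffordAlgebra.involute (boundary M x) =
      - -(_ - _ * boundary M (CliffordAlgebra.involute x))
    rw [hx]
    simp

theorem boundary_boundary (x : Ext M) : boundary M (boundary M x) = 0 :=
  CliffordAlgebra.contractLeft_contractLeft _ _

/-- The derivation `∂` preserves the Orlik–Solomon ideal. -/
theorem boundary_mem_osIdeal_of_mem {x : Ext M} (hx : x ∈ osIdeal M) :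
    boundary M x ∈ osIdeal M := by
  -- The Leibniz rule for `∂ (x * y)` contains `involute x * ∂ y`, so the induction over the
  -- two-sided ideal must carry stability under the grading involution along. On generators, `∂ ∂
  -- e_C = 0`.
  suffices h : CliffordAlgebra.involute x ∈ osIdeal M ∧ boundary M x ∈ osIdeal M from h.2
  have hx' : x ∈ TwoSidedIdeal.span (circuitBoundaries M) := TwoSidedIdeal.mem_asIdeal.1 hx
  have key : ∀ y ∈ TwoSidedIdeal.span (circuitBoundaries M), y ∈ osIdeal M := fun y hy =>
    TwoSidedIdeal.mem_asIdeal.2 hy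
  clear hx
  induction hx' using TwoSidedIdeal.span_induction with
  | mem y hy =>
    obtain ⟨l, hl, hC, rfl⟩ := hy
    rw [involute_boundary, involute_extMonomial, map_smul, boundary_boundary]
    refine ⟨neg_mem ?_, Ideal.zero_mem _⟩
    exact ((osIdeal M).restrictScalars ℂ).smul_mem _ (boundary_mem_osIdeal hl hC)
  | zero => simp
  | add a b _ _ ha hb =>
    rw [map_add, map_add]
    exact ⟨add_mem ha.1 hb.1, add_mem ha.2 hb.2⟩
  | neg a _ ha =>
    rw [map_neg, map_neg]
    exact ⟨neg_mem ha.1, neg_mem ha.2⟩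
  | left_absorb a b hb h =>
    rw [map_mul, boundary_mul]
    exact ⟨Ideal.mul_mem_left _ _ h.1, add_mem (Ideal.mul_mem_left _ _ (key _ hb))
      (Ideal.mul_mem_left _ _ h.2)⟩
  | right_absorb a b hb h =>
    rw [map_mul, boundary_mul]
    exact ⟨Ideal.mul_mem_right _ _ h.1, add_mem (Ideal.mul_mem_right _ _ h.2)
      (Ideal.mul_mem_right _ _ h.1)⟩

/-- The class of a monomial in the Orlik–Solomon algebra. -/
def osMonomial (M : Matroid α) (l : List M.E) : OSAlgebra M :=
  Ideal.Quotient.mk (osIdeal M) (extMonomial M l)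

theorem osMonomial_eq_zero {l : List M.E} (h : ¬ (l.Nodup ∧ M.Indep (supp l))) :
    osMonomial M l = 0 := Ideal.Quotient.eq_zero_iff_mem.2 (extMonomial_mem_osIdeal h)

/-- The exterior power is the `p`-th power of the submodule of generators, and a power of a span is
the span of the products. All linear statements in degree `p` are thereby checked on monomials. -/
theorem osDegree_eq_span (M : Matroid α) (p : ℕ) :
    osDegree M p = Submodule.span ℂ {x | ∃ l : List M.E, l.length = p ∧ x = osMonomial M l} := by
  have h1 : LinearMap.range (ExteriorAlgebra.ι ℂ (M := M.E →₀ ℂ)) =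
      Submodule.span ℂ (Set.range (extGen M)) := by
    refine le_antisymm ?_ (Submodule.span_le.2 ?_)
    · rintro _ ⟨m, rfl⟩
      induction m using Finsupp.induction_linear with
      | zero => simp
      | add f g hf hg => rw [map_add]; exact add_mem hf hg
      | single i c =>
        rw [← mul_one c, ← smul_eq_mul, ← Finsupp.smul_single, map_smul]
        exact Submodule.smul_mem _ _ (Submodule.subset_span ⟨i, rfl⟩)
    · rintro _ ⟨i, rfl⟩
      exact ⟨_, rfl⟩
  have h2 : ⋀[ℂ]^p (M.E →₀ ℂ) = Submodule.span ℂ {x | ∃ l : List M.E, l.length = p ∧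
      x = extMonomial M l} := by
    change LinearMap.range (ExteriorAlgebra.ι ℂ (M := M.E →₀ ℂ)) ^ p = _
    rw [h1, Submodule.span_pow]
    congr 1
    ext x
    rw [Set.mem_pow]
    constructor
    · rintro ⟨f, rfl⟩
      choose g hg using fun i => (f i).2
      refine ⟨List.ofFn g, List.length_ofFn, ?_⟩
      simp only [extMonomial, List.map_ofFn]
      congr 2
      funext i
      exact (hg i).symm
    · rintro ⟨l, rfl, rfl⟩
      refine ⟨fun i => ⟨extGen M (l.get i), l.get i, rfl⟩, ?_⟩
      simp only [extMonomial]
      congr 1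
      apply List.ext_get <;> simp
  rw [osDegree, h2, Submodule.map_span]
  congr 1
  ext x
  constructor
  · rintro ⟨_, ⟨l, hl, rfl⟩, rfl⟩
    exact ⟨l, hl, rfl⟩
  · rintro ⟨l, hl, rfl⟩
    exact ⟨_, ⟨l, hl, rfl⟩, rfl⟩

theorem osMonomial_mem_osDegree (l : List M.E) : osMonomial M l ∈ osDegree M l.length := by
  rw [osDegree_eq_span]
  exact Submodule.subset_span ⟨l, rfl, rfl⟩

end Monomials

/-! ### Maps between Orlik–Solomon algebras -/

section Functoriality

variable {α : Type v} {M N : Matroid α}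

/-- The algebra homomorphism between Orlik–Solomon algebras induced by a linear map between the
spaces of generators. -/
def osMap (f : (M.E →₀ ℂ) →ₗ[ℂ] (N.E →₀ ℂ))
    (hf : ∀ l : List M.E, l.Nodup → M.IsCircuit (supp l) →
      ExteriorAlgebra.map f (boundary M (extMonomial M l)) ∈ osIdeal N) :
    OSAlgebra M →ₐ[ℂ] OSAlgebra N :=
  Ideal.quotientMapₐ (osIdeal N) (ExteriorAlgebra.map f) fun x hx => by
    have h : TwoSidedIdeal.span (circuitBoundaries M) ≤
        (TwoSidedIdeal.span (circuitBoundaries N)).comap (ExteriorAlgebra.map f) := by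
      rw [TwoSidedIdeal.span_le]
      rintro _ ⟨l, hl, hC, rfl⟩
      rw [SetLike.mem_coe, TwoSidedIdeal.mem_comap]
      exact TwoSidedIdeal.mem_asIdeal.1 (hf l hl hC)
    exact TwoSidedIdeal.mem_asIdeal.2
      ((TwoSidedIdeal.mem_comap (ExteriorAlgebra.map f)).1 (h (TwoSidedIdeal.mem_asIdeal.1 hx)))

theorem map_extMonomial (f : (M.E →₀ ℂ) →ₗ[ℂ] (N.E →₀ ℂ)) (l : List M.E) :
    ExteriorAlgebra.map f (extMonomial M l) =
      (l.map fun i => ExteriorAlgebra.ι ℂ (f (Finsupp.single i 1))).prod := by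
  simp [extMonomial, map_list_prod, Function.comp_def]

/-- A linear map on the degree `p` part is determined by the values on monomials. -/
theorem osDegree_hom_ext {p : ℕ} {V : Type*} [AddCommGroup V] [Module ℂ V]
    {f g : osDegree M p →ₗ[ℂ] V}
    (h : ∀ (l : List M.E) (hl : l.length = p),
      f ⟨osMonomial M l, hl ▸ osMonomial_mem_osDegree l⟩ =
        g ⟨osMonomial M l, hl ▸ osMonomial_mem_osDegree l⟩) : f = g := by
  have key : osDegree M p ≤ (LinearMap.eqLocus f g).map (osDegree M p).subtype := by
    conv_lhs => rw [osDegree_eq_span]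
    rw [Submodule.span_le]
    rintro _ ⟨l, hl, rfl⟩
    exact ⟨_, h l hl, rfl⟩
  ext x
  obtain ⟨y, hy, hyx⟩ := key x.2
  rw [← Subtype.ext (a1 := y) (a2 := x) hyx]
  exact hy

theorem map_mem_osDegree {p q : ℕ} (f : OSAlgebra M →ₗ[ℂ] OSAlgebra N)
    (h : ∀ l : List M.E, l.length = p → f (osMonomial M l) ∈ osDegree N q) :
    ∀ x ∈ osDegree M p, f x ∈ osDegree N q := by
  intro x hx
  rw [osDegree_eq_span] at hx
  induction hx using Submodule.span_induction with
  | mem x hx =>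
    obtain ⟨l, hl, rfl⟩ := hx
    exact h l hl
  | zero => rw [map_zero]; exact zero_mem _
  | add x y _ _ h1 h2 => rw [map_add]; exact add_mem h1 h2
  | smul c x _ h1 => rw [map_smul]; exact Submodule.smul_mem _ _ h1

/-! ### Inclusion and projection between the Orlik–Solomon algebras of a matroid and of a flat. -/

section Restriction

variable {F : Set α} (hF : F ⊆ M.E)

/-- The inclusion of a subset into the ground set. -/
def incl (i : (M ↾ F).E) : M.E := ⟨i, hF i.2⟩

theorem incl_injective : Function.Injective (incl (M := M) hF) :=
  fun _ _ h => Subtype.ext (congrArg (fun x : M.E => (x : α)) h)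

theorem supp_map_incl (l : List (M ↾ F).E) : supp (l.map (incl hF)) = supp l := by
  ext a
  constructor
  · rintro ⟨i, hi, rfl⟩
    obtain ⟨j, hj, rfl⟩ := List.mem_map.1 hi
    exact ⟨j, hj, rfl⟩
  · rintro ⟨i, hi, rfl⟩
    exact ⟨_, List.mem_map_of_mem hi, rfl⟩

theorem exists_map_incl {l : List M.E} (h : ∀ i ∈ l, (i : α) ∈ F) :
    ∃ l' : List (M ↾ F).E, l = l'.map (incl hF) := by
  induction l with
  | nil => exact ⟨[], rfl⟩
  | cons i l ih =>
    obtain ⟨l', rfl⟩ := ih fun j hj => h j (List.mem_cons_of_mem _ hj)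
    exact ⟨⟨i, h i List.mem_cons_self⟩ :: l', rfl⟩

/-- The inclusion of generators. -/
def inclGen : ((M ↾ F).E →₀ ℂ) →ₗ[ℂ] (M.E →₀ ℂ) := Finsupp.lmapDomain ℂ ℂ (incl hF)

theorem inclGen_single (i : (M ↾ F).E) :
    inclGen hF (Finsupp.single i 1) = Finsupp.single (incl hF i) 1 := Finsupp.mapDomain_single

theorem map_inclGen_extMonomial (l : List (M ↾ F).E) :
    ExteriorAlgebra.map (inclGen hF) (extMonomial (M ↾ F) l) =
      extMonomial M (l.map (incl hF)) := by
  rw [map_extMonomial, extMonomial, List.map_map]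
  congr 1
  exact List.map_congr_left fun i _ => by rw [inclGen_single]; rfl

theorem map_inclGen_boundary (l : List (M ↾ F).E) :
    ExteriorAlgebra.map (inclGen hF) (boundary (M ↾ F) (extMonomial (M ↾ F) l)) =
      boundary M (extMonomial M (l.map (incl hF))) := by
  induction l with
  | nil => simp only [extMonomial_nil, List.map_nil, boundary_one, map_zero]
  | cons i l ih =>
    rw [List.map_cons, extMonomial_cons, extMonomial_cons, boundary_extGen_mul,
      boundary_extGen_mul, map_sub, map_mul, ih, map_inclGen_extMonomial,
      ExteriorAlgebra.map_apply_ι, inclGen_single]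

/-- The map from the Orlik–Solomon algebra of a restriction. -/
def osIncl : OSAlgebra (M ↾ F) →ₐ[ℂ] OSAlgebra M :=
  osMap (inclGen hF) fun l hl hC => by
    rw [map_inclGen_boundary]
    refine boundary_mem_osIdeal (hl.map (incl_injective hF)) ?_
    rw [supp_map_incl]
    exact ((Matroid.restrict_isCircuit_iff hF).1 hC).1

theorem osIncl_osMonomial (l : List (M ↾ F).E) :
    osIncl hF (osMonomial (M ↾ F) l) = osMonomial M (l.map (incl hF)) :=
  congrArg (Ideal.Quotient.mk (osIdeal M)) (map_inclGen_extMonomial hF l)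

open scoped Classical in
/-- The projection of generators to a subset. -/
def projGen (M : Matroid α) (F : Set α) : (M.E →₀ ℂ) →ₗ[ℂ] ((M ↾ F).E →₀ ℂ) :=
  Finsupp.linearCombination ℂ fun i : M.E =>
    if h : (i : α) ∈ F then Finsupp.single (⟨i, h⟩ : (M ↾ F).E) (1 : ℂ) else 0

theorem projGen_single_of_notMem {i : M.E} (h : (i : α) ∉ F) :
    projGen M F (Finsupp.single i 1) = 0 := by
  rw [projGen, Finsupp.linearCombination_single, dif_neg h, smul_zero]

theorem projGen_single_incl (i : (M ↾ F).E) :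
    projGen M F (Finsupp.single (incl hF i) 1) = Finsupp.single i 1 := by
  have h : (incl hF i : α) ∈ F := i.2
  rw [projGen, Finsupp.linearCombination_single, dif_pos h, one_smul]
  rfl

theorem projGen_comp_inclGen : projGen M F ∘ₗ inclGen hF = LinearMap.id := by
  refine Finsupp.lhom_ext' fun i => LinearMap.ext_ring ?_
  exact (congrArg _ (inclGen_single hF i)).trans (projGen_single_incl hF i)

theorem map_projGen_map_inclGen (x : Ext (M ↾ F)) :
    ExteriorAlgebra.map (projGen M F) (ExteriorAlgebra.map (inclGen hF) x) = x := by
  rw [← AlgHom.comp_apply, ExteriorAlgebra.map_comp_map, projGen_comp_inclGen,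
    ExteriorAlgebra.map_id, AlgHom.id_apply]

theorem map_projGen_extMonomial_of_notMem {l : List M.E} {i : M.E} (hi : i ∈ l)
    (h : (i : α) ∉ F) : ExteriorAlgebra.map (projGen M F) (extMonomial M l) = 0 := by
  rw [map_extMonomial]
  refine List.prod_eq_zero (List.mem_map.2 ⟨i, hi, ?_⟩)
  rw [projGen_single_of_notMem h, map_zero]

/-- A circuit that is not contained in a flat has two elements outside it. -/
theorem exists_perm_cons_cons (hFl : M.IsFlat F) {l : List M.E} (hl : l.Nodup)
    (hC : M.IsCircuit (supp l)) (h : ¬ ∀ i ∈ l, (i : α) ∈ F) :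
    ∃ (i j : M.E) (t : List M.E), (i : α) ∉ F ∧ (j : α) ∉ F ∧ l.Perm (i :: j :: t) := by
  classical
  push Not at h
  obtain ⟨i, hi, hiF⟩ := h
  have hp := List.perm_cons_erase hi
  by_cases h' : ∀ j ∈ l.erase i, (j : α) ∈ F
  · exfalso
    refine hiF ?_
    -- An element of a circuit lies in the closure of the others, hence in the flat `F` if the
    -- others do.
    have h1 := hC.mem_closure_sdiff_singleton_of_mem (coe_mem_supp.2 hi)
    rw [← hFl.closure]
    refine M.closure_subset_closure ?_ h1
    rintro a ⟨⟨j, hj, rfl⟩, hji⟩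
    refine h' j ((hl.mem_erase_iff).2 ⟨?_, hj⟩)
    rintro rfl
    exact hji rfl
  · push Not at h'
    obtain ⟨j, hj, hjF⟩ := h'
    exact ⟨i, j, _, hiF, hjF, hp.trans ((List.perm_cons_erase hj).cons i)⟩

/-- The projection to the Orlik–Solomon algebra of the restriction to a flat. -/
def osProj (hFl : M.IsFlat F) : OSAlgebra M →ₐ[ℂ] OSAlgebra (M ↾ F) :=
  osMap (projGen M F) fun l hl hC => by
    by_cases h : ∀ i ∈ l, (i : α) ∈ F
    · obtain ⟨l', rfl⟩ := exists_map_incl hFl.subset_ground h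
      rw [← map_inclGen_boundary, map_projGen_map_inclGen]
      rw [supp_map_incl] at hC
      exact boundary_mem_osIdeal hl.of_map
        ((Matroid.restrict_isCircuit_iff hFl.subset_ground).2 ⟨hC, fun a ⟨i, _, hi⟩ => hi ▸ i.2⟩)
    -- Each term of `∂ e_C` omits only one element, so it keeps a factor outside `F`, which the
    -- projection kills. This is where `F` has to be a flat.
    · obtain ⟨i, j, t, hi, hj, hp⟩ := exists_perm_cons_cons hFl hl hC h
      suffices h0 : ExteriorAlgebra.map (projGen M F)
          (boundary M (extMonomial M (i :: j :: t))) = 0 by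
        rcases extMonomial_perm hp with h | h
        · rw [h, h0]; exact zero_mem _
        · rw [h, map_neg, map_neg, h0, neg_zero]; exact zero_mem _
      rw [extMonomial_cons, boundary_extGen_mul, map_sub,
        map_projGen_extMonomial_of_notMem List.mem_cons_self hj, map_mul,
        ExteriorAlgebra.map_apply_ι, projGen_single_of_notMem hi, map_zero, zero_mul, sub_zero]

theorem osProj_osMonomial_map (hFl : M.IsFlat F) (l : List (M ↾ F).E) :
    osProj hFl (osMonomial M (l.map (incl hFl.subset_ground))) = osMonomial (M ↾ F) l := by
  refine congrArg (Ideal.Quotient.mk (osIdeal (M ↾ F)))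
    (?_ : ExteriorAlgebra.map (projGen M F) _ = _)
  rw [← map_inclGen_extMonomial, map_projGen_map_inclGen]

theorem osProj_osMonomial_of_notMem (hFl : M.IsFlat F) {l : List M.E} {i : M.E} (hi : i ∈ l)
    (h : (i : α) ∉ F) : osProj hFl (osMonomial M l) = 0 :=
  (congrArg (Ideal.Quotient.mk (osIdeal (M ↾ F))) (map_projGen_extMonomial_of_notMem hi h)).trans
    (map_zero _)

/-- `osIncl` in degree `p`. -/
def osInclDeg (p : ℕ) : osDegree (M ↾ F) p →ₗ[ℂ] osDegree M p :=
  (osIncl hF).toLinearMap.restrict <| map_mem_osDegree _ fun l hl => by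
    change osIncl hF (osMonomial (M ↾ F) l) ∈ _
    rw [osIncl_osMonomial]
    have := osMonomial_mem_osDegree (l.map (incl hF))
    rwa [List.length_map, hl] at this

/-- `osProj` in degree `p`. -/
def osProjDeg (hFl : M.IsFlat F) (p : ℕ) : osDegree M p →ₗ[ℂ] osDegree (M ↾ F) p :=
  (osProj hFl).toLinearMap.restrict <| map_mem_osDegree _ fun l hl => by
    change osProj hFl (osMonomial M l) ∈ _
    by_cases h : ∀ i ∈ l, (i : α) ∈ F
    · obtain ⟨l', rfl⟩ := exists_map_incl hFl.subset_ground h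
      rw [osProj_osMonomial_map]
      rw [List.length_map] at hl
      exact hl ▸ osMonomial_mem_osDegree l'
    · push Not at h
      obtain ⟨i, hi, hiF⟩ := h
      rw [osProj_osMonomial_of_notMem hFl hi hiF]
      exact zero_mem _

end Restriction

end Functoriality

/-! ### The contracting homotopy -/

section Homotopy

variable {α : Type v} {M : Matroid α}

/-- The derivation `∂` on the Orlik–Solomon algebra. -/
def osBoundary (M : Matroid α) : OSAlgebra M →ₗ[ℂ] OSAlgebra M :=
  (Submodule.Quotient.restrictScalarsEquiv ℂ (osIdeal M)).toLinearMap ∘ₗ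
    Submodule.mapQ ((osIdeal M).restrictScalars ℂ) ((osIdeal M).restrictScalars ℂ) (boundary M)
      (fun _ hx => boundary_mem_osIdeal_of_mem hx) ∘ₗ
    (Submodule.Quotient.restrictScalarsEquiv ℂ (osIdeal M)).symm.toLinearMap

theorem osBoundary_mk (x : Ext M) : osBoundary M (Ideal.Quotient.mk (osIdeal M) x) =
    Ideal.Quotient.mk (osIdeal M) (boundary M x) := rfl

/-- The class of a generator. -/
def osGen (M : Matroid α) (i : M.E) : OSAlgebra M := Ideal.Quotient.mk (osIdeal M) (extGen M i)

theorem osMonomial_cons (i : M.E) (l : List M.E) :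
    osMonomial M (i :: l) = osGen M i * osMonomial M l := by
  rw [osMonomial, extMonomial_cons, map_mul]
  rfl

/-- This is the homotopy identity `∂ e_i + e_i ∂ = id`: multiplication by any generator contracts
the complex. -/
theorem osBoundary_osGen_mul (i : M.E) (x : OSAlgebra M) :
    osBoundary M (osGen M i * x) = x - osGen M i * osBoundary M x := by
  obtain ⟨y, rfl⟩ := Ideal.Quotient.mk_surjective x
  rw [osGen, ← map_mul, osBoundary_mk, osBoundary_mk, boundary_extGen_mul, map_sub, map_mul]

theorem osGen_mul_mem (i : M.E) (p : ℕ) :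
    ∀ x ∈ osDegree M p, LinearMap.mulLeft ℂ (osGen M i) x ∈ osDegree M (p + 1) :=
  map_mem_osDegree _ fun l hl => by
    rw [LinearMap.mulLeft_apply, ← osMonomial_cons, ← hl]
    exact osMonomial_mem_osDegree (i :: l)

theorem osBoundary_osMonomial_nil : osBoundary M (osMonomial M []) = 0 := by
  rw [osMonomial, osBoundary_mk, extMonomial_nil, boundary_one, map_zero]

theorem osBoundary_osMonomial_mem (l : List M.E) :
    ∀ p, l.length = p + 1 → osBoundary M (osMonomial M l) ∈ osDegree M p := by
  induction l with
  | nil => simp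
  | cons i l ih =>
    intro p hp
    rw [List.length_cons, add_left_inj] at hp
    rw [osMonomial_cons, osBoundary_osGen_mul]
    refine sub_mem (hp ▸ osMonomial_mem_osDegree l) ?_
    cases p with
    | zero =>
      rw [List.length_eq_zero_iff.1 hp, osBoundary_osMonomial_nil, mul_zero]
      exact zero_mem _
    | succ p => exact osGen_mul_mem i p _ (ih p hp)

theorem osBoundary_mem (p : ℕ) : ∀ x ∈ osDegree M (p + 1), osBoundary M x ∈ osDegree M p :=
  map_mem_osDegree _ fun l hl => osBoundary_osMonomial_mem l p hl

theorem osBoundary_of_mem_osDegree_zero {x : OSAlgebra M} (hx : x ∈ osDegree M 0) :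
    osBoundary M x = 0 := by
  rw [osDegree_eq_span] at hx
  induction hx using Submodule.span_induction with
  | mem x hx =>
    obtain ⟨l, hl, rfl⟩ := hx
    rw [List.length_eq_zero_iff.1 hl, osBoundary_osMonomial_nil]
  | zero => rw [map_zero]
  | add x y _ _ h1 h2 => rw [map_add, h1, h2, add_zero]
  | smul c x _ h1 => rw [map_smul, h1, smul_zero]

/-- A monomial of degree `p` can be nonzero only if its support is an independent set with `p`
elements. -/
theorem osDegree_eq_bot {p : ℕ} (hp : M.eRank < p) : osDegree M p = ⊥ := by
  rw [osDegree_eq_span, Submodule.span_eq_bot]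
  rintro _ ⟨l, rfl, rfl⟩
  refine osMonomial_eq_zero fun h => hp.not_ge ?_
  rw [← encard_supp h.1]
  exact h.2.encard_le_eRank

end Homotopy

/-! ### Traces on the Orlik–Solomon algebra -/

namespace EquivariantMatroid

variable {W : Type u} [Group W] {α : Type v} (X : EquivariantMatroid W α)

/-- The character of the degree `p` part of the Orlik–Solomon algebra at `w`. -/
def osTrace (p : ℕ) (w : W) : ℂ := (X.osClass p : W → ℂ) w

theorem osTrace_eq (p : ℕ) (w : W) :
    X.osTrace p w = LinearMap.trace ℂ (osDegree X.M p) (X.osRep p w) := rfl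

theorem osAct_osMonomial (w : W) (l : List X.M.E) :
    X.osAct w (osMonomial X.M l) = osMonomial X.M (l.map (X.groundPerm w)) :=
  congrArg (Ideal.Quotient.mk (osIdeal X.M)) (X.extAct_monomial w l)

theorem coe_groundPerm (w : W) (i : X.M.E) : (X.groundPerm w i : α) = X.act w i := rfl

instance : X.M.Finite := ⟨X.finite⟩

theorem eRk_ne_top (F : Set α) : X.M.eRk F ≠ ⊤ :=
  Matroid.eRk_ne_top_iff.2 (X.M.isRkFinite_set F)

theorem eRk_eq_flatRank (F : X.Flat) : X.M.eRk F.1 = X.flatRank F :=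
  (ENat.natCast_toNat (X.eRk_ne_top _)).symm

theorem eRank_eq_rank : X.M.eRank = X.rank := by
  rw [rank, ENat.natCast_toNat]
  rw [Matroid.eRank_def]
  exact X.eRk_ne_top _

/-- A flat that contains an independent set of the same rank is its closure. -/
theorem closure_eq_flat {I : Set α} (hI : X.M.Indep I) (F : X.Flat) (hIF : I ⊆ F.1)
    (h : I.encard = X.flatRank F) : X.M.closure I = F.1 := by
  rw [← F.2.closure]
  refine (X.M.isRkFinite_set I).closure_eq_closure_of_subset_of_eRk_ge_eRk hIF ?_
  rw [X.eRk_eq_flatRank, ← h, hI.eRk_eq_encard]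

theorem image_eq_of_subset {F : Set α} (hF : F ⊆ X.M.E) {w : W} (h : X.act w '' F ⊆ F) :
    X.act w '' F = F :=
  ((X.finite.subset hF).image _).eq_of_subset_of_encard_le h
    ((X.act w).injective.encard_image F).ge

/-- The part of the Orlik–Solomon algebra that comes from a flat of rank `p` is preserved by `w`
only if the flat is. -/
theorem osProjDeg_osRep_osInclDeg_of_ne (F : X.Flat) {p : ℕ} (hp : X.flatRank F = p) {w : W}
    (hw : w • F ≠ F) :
    osProjDeg F.2 p ∘ₗ X.osRep p w ∘ₗ osInclDeg F.2.subset_ground p = 0 := by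
  refine osDegree_hom_ext fun l hl => Subtype.ext ?_
  change osProj F.2 (X.osAct w (osIncl F.2.subset_ground (osMonomial _ l))) = 0
  rw [osIncl_osMonomial, osAct_osMonomial]
  by_cases hi : (l.map (incl F.2.subset_ground)).Nodup ∧
      X.M.Indep (supp (l.map (incl F.2.subset_ground)))
  · by_cases h : ∀ i ∈ (l.map (incl F.2.subset_ground)).map (X.groundPerm w), (i : α) ∈ F.1
    · exfalso
      -- The monomial is supported on a basis `supp m` of `F`. If `w` maps that basis into `F`, then
      -- `supp m ⊆ w⁻¹ F`, and taking closures gives `F ⊆ w⁻¹ F`.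
      refine hw (Subtype.ext (X.image_eq_of_subset F.2.subset_ground ?_))
      set m := l.map (incl F.2.subset_ground) with hm
      have hmF : supp m ⊆ F.1 := by
        rw [hm, supp_map_incl]
        rintro _ ⟨i, _, rfl⟩
        exact i.2
      have hmw : supp m ⊆ X.act w⁻¹ '' F.1 := by
        rintro _ ⟨i, hi, rfl⟩
        refine ⟨_, h _ (List.mem_map_of_mem hi), ?_⟩
        rw [coe_groundPerm, ← Equiv.Perm.mul_apply, ← map_mul, inv_mul_cancel, map_one,
          Equiv.Perm.one_apply]
      have hlen : (supp m).encard = X.flatRank F := by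
        rw [encard_supp hi.1, hm, List.length_map, hl, hp]
      have h1 := X.closure_eq_flat hi.2 F hmF hlen
      have h2 : F.1 ⊆ X.act w⁻¹ '' F.1 := by
        conv_lhs => rw [← h1]
        rw [← (X.isFlat_image w⁻¹ F.2).closure]
        exact X.M.closure_subset_closure hmw
      rintro _ ⟨a, ha, rfl⟩
      obtain ⟨b, hb, rfl⟩ := h2 ha
      rwa [← Equiv.Perm.mul_apply, ← map_mul, mul_inv_cancel, map_one, Equiv.Perm.one_apply]
    · push Not at h
      obtain ⟨i, hi, hiF⟩ := h
      exact osProj_osMonomial_of_notMem F.2 hi hiF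
  · rw [← osAct_osMonomial, osMonomial_eq_zero hi, map_zero, map_zero]

/-- For a fixed flat, the diagonal block of `w` in the decomposition by flats is the action on the
localization. -/
theorem osProjDeg_osRep_osInclDeg (F : X.Flat) (p : ℕ) (w : X.stab F) :
    osProjDeg F.2 p ∘ₗ X.osRep p w ∘ₗ osInclDeg F.2.subset_ground p =
      (X.localize F).osRep p w := by
  refine osDegree_hom_ext fun l hl => Subtype.ext ?_
  change osProj F.2 (X.osAct w (osIncl F.2.subset_ground (osMonomial _ l))) =
    (X.localize F).osAct w (osMonomial _ l)
  have h : (l.map (incl F.2.subset_ground)).map (X.groundPerm w) =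
      (l.map ((X.localize F).groundPerm w)).map (incl F.2.subset_ground) := by
    refine List.map_map.trans (Eq.trans ?_ List.map_map.symm)
    rfl
  rw [osIncl_osMonomial, osAct_osMonomial, h]
  exact (osProj_osMonomial_map F.2 _).trans ((X.localize F).osAct_osMonomial w l).symm

-- This is Brieskorn's decomposition: an independent set of size `p` lies in exactly one flat of
-- rank `p`, namely its closure, so exactly one summand reproduces its monomial and the others kill
-- it.
open scoped Classical in
theorem sum_osInclDeg_osProjDeg [Fintype X.Flat] (p : ℕ) :
    ∑ F : X.Flat with X.flatRank F = p,
      osInclDeg F.2.subset_ground p ∘ₗ osProjDeg F.2 p = LinearMap.id := by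
  refine osDegree_hom_ext fun l hl => Subtype.ext ?_
  rw [LinearMap.sum_apply, LinearMap.id_apply, AddSubmonoidClass.coe_finsetSum]
  change ∑ F : X.Flat with _, osIncl F.2.subset_ground (osProj F.2 (osMonomial _ l)) = _
  by_cases hi : l.Nodup ∧ X.M.Indep (supp l)
  · set F₀ : X.Flat := ⟨X.M.closure (supp l), X.M.isFlat_closure _⟩ with hF₀
    have hsub : supp l ⊆ F₀.1 := X.M.subset_closure _ (supp_subset_ground l)
    rw [Finset.sum_eq_single_of_mem F₀]
    · obtain ⟨l', hl'⟩ := exists_map_incl F₀.2.subset_ground fun i hi =>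
        hsub (coe_mem_supp.2 hi)
      conv_lhs => rw [hl', osProj_osMonomial_map, osIncl_osMonomial, ← hl']
    · rw [Finset.mem_filter_univ, flatRank, Matroid.eRk_closure_eq, hi.2.eRk_eq_encard,
        encard_supp hi.1, hl, ENat.toNat_natCast]
    · intro F hF hne
      rw [Finset.mem_filter_univ] at hF
      suffices h : ¬ ∀ i ∈ l, (i : α) ∈ F.1 by
        push Not at h
        obtain ⟨i, hi, hiF⟩ := h
        rw [osProj_osMonomial_of_notMem F.2 hi hiF, map_zero]
      intro h
      refine hne (Subtype.ext (X.closure_eq_flat hi.2 F ?_ ?_).symm)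
      · rintro _ ⟨i, hi, rfl⟩
        exact h i hi
      · rw [encard_supp hi.1, hl, hF]
  · simp only [osMonomial_eq_zero hi, map_zero, Finset.sum_const_zero]

open scoped Classical in
/-- The decomposition of the Orlik–Solomon algebra by flats, on the level of characters. -/
theorem osTrace_eq_sum [Fintype X.Flat] (p : ℕ) (w : W) :
    X.osTrace p w = ∑ F : X.Flat with X.flatRank F = p,
      if h : w • F = F then (X.localize F).osTrace p ⟨w, h⟩ else 0 := by
  have h1 : X.osRep p w = ∑ F : X.Flat with X.flatRank F = p,
      (X.osRep p w ∘ₗ osInclDeg F.2.subset_ground p) ∘ₗ osProjDeg F.2 p := by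
    conv_lhs => rw [← LinearMap.comp_id (X.osRep p w), ← X.sum_osInclDeg_osProjDeg p]
    ext x
    simp
  rw [osTrace_eq, h1, map_sum]
  refine Finset.sum_congr rfl fun F hF => ?_
  rw [Finset.mem_filter_univ] at hF
  have : FiniteDimensional ℂ (osDegree (X.M ↾ F.1) p) :=
    inferInstanceAs (FiniteDimensional ℂ (osDegree (X.localize F).M p))
  -- Cyclicity of the trace turns the summand of `F` into the trace of the diagonal block at `F`.
  rw [LinearMap.trace_comp_comm' (osProjDeg F.2 p)]
  split_ifs with h
  · rw [osTrace_eq]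
    exact congrArg _ (X.osProjDeg_osRep_osInclDeg F p ⟨w, h⟩)
  · rw [X.osProjDeg_osRep_osInclDeg_of_ne F hF h, map_zero]

theorem osTrace_eq_zero {p : ℕ} (hp : X.rank < p) (w : W) : X.osTrace p w = 0 := by
  have h : osDegree X.M p = ⊥ := osDegree_eq_bot (by rw [eRank_eq_rank]; exact_mod_cast hp)
  have : Subsingleton (osDegree X.M p) := by rw [h]; infer_instance
  rw [osTrace_eq, Subsingleton.elim (X.osRep p w) 0, map_zero]

/-! ### Acyclicity of `∂` and the alternating sum of the traces. -/

theorem osAct_osBoundary (w : W) (x : OSAlgebra X.M) :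
    X.osAct w (osBoundary X.M x) = osBoundary X.M (X.osAct w x) := by
  obtain ⟨y, rfl⟩ := Ideal.Quotient.mk_surjective x
  exact congrArg (Ideal.Quotient.mk (osIdeal X.M)) (X.extAct_boundary w y)

/-- The alternating sum of the characters of the graded pieces of the Orlik–Solomon algebra
vanishes, since the derivation `∂` makes it into an acyclic complex. -/
theorem sum_neg_one_pow_mul_osTrace (i : X.M.E) (w : W) :
    ∑ p ∈ Finset.range (X.rank + 1), (-1) ^ p * X.osTrace p w = 0 := by
  let d (p : ℕ) : osDegree X.M (p + 1) →ₗ[ℂ] osDegree X.M p :=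
    (osBoundary X.M).restrict (osBoundary_mem p)
  let e (p : ℕ) : osDegree X.M p →ₗ[ℂ] osDegree X.M (p + 1) :=
    (LinearMap.mulLeft ℂ (osGen X.M i)).restrict (osGen_mul_mem i p)
  have hd (p : ℕ) : X.osRep p w ∘ₗ d p = d p ∘ₗ X.osRep (p + 1) w := by
    ext x
    exact X.osAct_osBoundary w x
  have h0 : d 0 ∘ₗ e 0 = LinearMap.id := by
    ext x
    change osBoundary X.M (osGen X.M i * x) = x
    rw [osBoundary_osGen_mul, osBoundary_of_mem_osDegree_zero x.2, mul_zero, sub_zero]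
  have hs (p : ℕ) : d (p + 1) ∘ₗ e (p + 1) + e p ∘ₗ d p = LinearMap.id := by
    ext x
    change osBoundary X.M (osGen X.M i * x) + osGen X.M i * osBoundary X.M x = x
    rw [osBoundary_osGen_mul, sub_add_cancel]
  -- Here `a p` is the trace of `w e_i ∂` in degree `p`, with value `0` in degree `0`, where `∂`
  -- vanishes. The trace in degree `p` will be `a p + a (p + 1)`, so the alternating sum telescopes.
  let a : ℕ → ℂ := fun p => Nat.casesOn p 0 fun q =>
    LinearMap.trace ℂ _ (X.osRep (q + 1) w ∘ₗ (e q ∘ₗ d q))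
  -- Only `∂` commutes with `w`; multiplication by `e_i` need not. Moving `∂` past `w` and then
  -- cyclically around the trace is enough.
  have hde (p : ℕ) : LinearMap.trace ℂ _ (X.osRep p w ∘ₗ (d p ∘ₗ e p)) = a (p + 1) := by
    rw [← LinearMap.comp_assoc, hd, LinearMap.comp_assoc, LinearMap.trace_comp_comm',
      LinearMap.comp_assoc]
  have ha (p : ℕ) : X.osTrace p w = a p + a (p + 1) := by
    cases p with
    | zero =>
      rw [← hde, h0, LinearMap.comp_id]
      exact (zero_add _).symm
    | succ p =>
      rw [← hde (p + 1), add_comm (a (p + 1))]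
      change _ = _ + LinearMap.trace ℂ _ (X.osRep (p + 1) w ∘ₗ (e p ∘ₗ d p))
      rw [← map_add, ← LinearMap.comp_add, hs, LinearMap.comp_id]
      rfl
  have htop : a (X.rank + 1) = 0 := by
    have h : osDegree X.M (X.rank + 1) = ⊥ :=
      osDegree_eq_bot (by rw [eRank_eq_rank]; exact_mod_cast Nat.lt_succ_self _)
    have : Subsingleton (osDegree X.M (X.rank + 1)) := by rw [h]; infer_instance
    change LinearMap.trace ℂ _ (X.osRep (X.rank + 1) w ∘ₗ (e X.rank ∘ₗ d X.rank)) = 0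
    rw [Subsingleton.elim (X.osRep (X.rank + 1) w ∘ₗ (e X.rank ∘ₗ d X.rank)) 0, map_zero]
  have hsum : ∀ n, ∑ p ∈ Finset.range (n + 1), (-1) ^ p * X.osTrace p w =
      (-1) ^ n * a (n + 1) := by
    intro n
    induction n with
    | zero =>
      rw [Finset.sum_range_one, ha]
      change (-1) ^ 0 * (0 + _) = _
      rw [zero_add]
    | succ n ih =>
      rw [Finset.sum_range_succ, ih, ha (n + 1), pow_succ]
      ring
  rw [hsum, htop, mul_zero]

theorem osTrace_zero_of_ground_eq_empty (h : X.M.E = ∅) (w : W) : X.osTrace 0 w = 1 := by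
  have hspan : osDegree X.M 0 = Submodule.span ℂ {1} := by
    rw [osDegree_eq_span]
    congr 1
    ext x
    constructor
    · rintro ⟨l, hl, rfl⟩
      rw [List.length_eq_zero_iff.1 hl]
      rfl
    · rintro rfl
      exact ⟨[], rfl, rfl⟩
  have hC : circuitBoundaries X.M = ∅ := by
    rw [Set.eq_empty_iff_forall_notMem]
    rintro x ⟨l, _, hC, _⟩
    obtain ⟨a, ha⟩ := hC.nonempty
    have := hC.subset_ground ha
    rw [h] at this
    exact this
  have hI : osIdeal X.M = ⊥ := by
    have h' : TwoSidedIdeal.span (circuitBoundaries X.M) = ⊥ := by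
      rw [hC, eq_bot_iff, TwoSidedIdeal.span_le]
      exact Set.empty_subset _
    rw [osIdeal, h', TwoSidedIdeal.bot_asIdeal]
  have hne : (1 : OSAlgebra X.M) ≠ 0 := by
    intro h1
    rw [← map_one (Ideal.Quotient.mk (osIdeal X.M)), Ideal.Quotient.eq_zero_iff_mem, hI,
      Ideal.mem_bot] at h1
    exact one_ne_zero h1
  have hid : X.osRep 0 w = LinearMap.id := by
    refine osDegree_hom_ext fun l hl => Subtype.ext ?_
    change X.osAct w (osMonomial X.M l) = osMonomial X.M l
    rw [osAct_osMonomial, List.length_eq_zero_iff.1 hl]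
    rfl
  rw [osTrace_eq, hid, LinearMap.trace_id, hspan, finrank_span_singleton hne, Nat.cast_one]

end EquivariantMatroid

/-! ### Flats fixed by an automorphism of a matroid -/

section FixedFlats

variable {α : Type v} {M : Matroid α} {σ : Equiv.Perm α}

/-- `σ` is an automorphism of the finite loopless matroid `M`. -/
structure IsAut (M : Matroid α) (σ : Equiv.Perm α) : Prop where
  finite : M.E.Finite
  loopless : M.Loopless
  map_eq : M.mapEquiv σ = M

/-- The rank of a matroid of finite rank, as a natural number. -/
def rk (M : Matroid α) : ℕ := M.eRank.toNat

/-- The flats that are fixed by `σ`. -/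
def fixedFlats (M : Matroid α) (σ : Equiv.Perm α) : Finset (Set α) :=
  open scoped Classical in
  if h : M.E.Finite then
    (h.finite_subsets.subset fun _ hF => hF.1.subset_ground :
      {F | M.IsFlat F ∧ σ '' F = F}.Finite).toFinset
  else ∅

theorem mem_fixedFlats (h : M.E.Finite) {F : Set α} :
    F ∈ fixedFlats M σ ↔ M.IsFlat F ∧ σ '' F = F := by
  simp [fixedFlats, h]

/-- Because `fixedFlats` is empty for an infinite ground set, membership alone forces finiteness.
Hence the recursions for `mo` and `kl` terminate on arbitrary matroids, without assuming `IsAut`. -/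
theorem subset_of_mem_fixedFlats {F : Set α} (hF : F ∈ fixedFlats M σ) :
    M.E.Finite ∧ F ⊆ M.E := by
  by_cases h : M.E.Finite
  · exact ⟨h, ((mem_fixedFlats h).1 hF).1.subset_ground⟩
  · simp [fixedFlats, h] at hF

theorem ncard_restrict_lt {F : Set α} (hF : F ∈ fixedFlats M σ) (hne : F ≠ M.E) :
    (M ↾ F).E.ncard < M.E.ncard :=
  have h1 := subset_of_mem_fixedFlats hF
  Set.ncard_lt_ncard (h1.2.ssubset_of_ne hne) h1.1

theorem ncard_contract_lt {F : Set α} (hF : F ∈ fixedFlats M σ) (hne : F ≠ ∅) :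
    (M ／ F).E.ncard < M.E.ncard := by
  have h1 := subset_of_mem_fixedFlats hF
  refine Set.ncard_lt_ncard (Set.sdiff_subset.ssubset_of_ne fun h => ?_) h1.1
  obtain ⟨a, ha⟩ := Set.nonempty_iff_ne_empty.2 hne
  have h2 := h1.2 ha
  rw [← show (M ／ F).E = M.E from h] at h2
  exact h2.2 ha

theorem coe_rk (h : M.E.Finite) : (rk M : ℕ∞) = M.eRank := by
  have : M.Finite := ⟨h⟩
  rw [rk, ENat.natCast_toNat (Matroid.eRank_ne_top_iff _ |>.2 inferInstance)]

/-- The dual of `M ／ F` is the restriction of `M✶` to `M.E \ F`; the identity follows by eliminating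
the dual rank of `M.E \ F` from the two rank formulas for duals. -/
theorem rk_restrict_add_rk_contract (h : M.E.Finite) {F : Set α} (hF : F ⊆ M.E) :
    rk (M ↾ F) + rk (M ／ F) = rk M := by
  have h1 := Matroid.eRank_add_eRank_dual (M ／ F)
  have h2 := M.eRk_dual_add_eRank (M.E \ F) Set.sdiff_subset
  rw [Set.sdiff_sdiff_cancel_left hF] at h2
  have h3 : (M ／ F)✶.eRank = M✶.eRk (M.E \ F) := by
    rw [Matroid.dual_contract]
    rfl
  rw [h3, Matroid.contract_ground] at h1
  have hn : (M.E \ F).encard ≠ ⊤ := Set.encard_ne_top_iff.2 (h.subset Set.sdiff_subset)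
  have hd : M✶.eRk (M.E \ F) ≠ ⊤ := ne_top_of_le_ne_top hn (M✶.eRk_le_encard _)
  have e1 := coe_rk (M := M) h
  have e2 := coe_rk (M := M ↾ F) (h.subset hF)
  have e3 := coe_rk (M := M ／ F) (h.subset Set.sdiff_subset)
  rw [Matroid.eRank_restrict] at e2
  rw [← e3] at h1
  rw [← e1, ← e2] at h2
  lift (M.E \ F).encard to ℕ using hn with n
  lift M✶.eRk (M.E \ F) to ℕ using hd with d
  norm_cast at h1 h2
  omega

theorem rk_eq_zero_iff (h : M.E.Finite) (hl : M.Loopless) : rk M = 0 ↔ M.E = ∅ := by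
  rw [← Nat.cast_inj (R := ℕ∞), coe_rk h, Nat.cast_zero, Matroid.eRank_def,
    Matroid.eRk_eq_zero_iff le_rfl, hl.loops_eq_empty, Set.subset_empty_iff]

/-! ### Fixed flats of restrictions and contractions. -/

namespace IsAut

variable (h : IsAut M σ)
include h

theorem image_ground : σ '' M.E = M.E := by
  conv_rhs => rw [← h.map_eq]
  rw [Matroid.mapEquiv_ground_eq]

theorem ground_mem : M.E ∈ fixedFlats M σ :=
  (mem_fixedFlats h.finite).2 ⟨M.ground_isFlat, h.image_ground⟩

theorem empty_mem : ∅ ∈ fixedFlats M σ := by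
  refine (mem_fixedFlats h.finite).2 ⟨?_, Set.image_empty _⟩
  rw [Matroid.isFlat_iff_closure_eq]
  exact h.loopless.loops_eq_empty

theorem isFlat {F : Set α} (hF : F ∈ fixedFlats M σ) : M.IsFlat F :=
  ((mem_fixedFlats h.finite).1 hF).1

theorem image_eq {F : Set α} (hF : F ∈ fixedFlats M σ) : σ '' F = F :=
  ((mem_fixedFlats h.finite).1 hF).2

theorem restrict {F : Set α} (hF : F ∈ fixedFlats M σ) : IsAut (M ↾ F) σ where
  finite := h.finite.subset (h.isFlat hF).subset_ground
  loopless := by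
    have := h.loopless
    exact (Matroid.restrict_isRestriction M F (h.isFlat hF).subset_ground).loopless
  map_eq := EquivariantMatroid.mapEquiv_restrict h.map_eq (h.image_eq hF)

theorem contract {F : Set α} (hF : F ∈ fixedFlats M σ) : IsAut (M ／ F) σ where
  finite := h.finite.subset Set.sdiff_subset
  loopless := by
    rw [Matroid.loopless_iff_forall_not_isLoop]
    intro e _ he
    rw [Matroid.contract_isLoop_iff_mem_closure, (h.isFlat hF).closure] at he
    exact he.2 he.1
  map_eq := EquivariantMatroid.mapEquiv_contract h.map_eq (h.image_eq hF)

theorem rk_add {F : Set α} (hF : F ∈ fixedFlats M σ) : rk (M ↾ F) + rk (M ／ F) = rk M :=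
  rk_restrict_add_rk_contract h.finite (h.isFlat hF).subset_ground

theorem rk_restrict_lt {F : Set α} (hF : F ∈ fixedFlats M σ) (hne : F ≠ M.E) :
    rk (M ↾ F) < rk M := by
  have h1 := h.rk_add hF
  have h2 : rk (M ／ F) ≠ 0 := by
    rw [Ne, rk_eq_zero_iff (h.contract hF).finite (h.contract hF).loopless,
      Matroid.contract_ground, Set.sdiff_eq_empty]
    exact fun h3 => hne ((h.isFlat hF).subset_ground.antisymm h3)
  omega

theorem mem_restrict_iff {F G : Set α} (hF : F ∈ fixedFlats M σ) :
    G ∈ fixedFlats (M ↾ F) σ ↔ G ∈ fixedFlats M σ ∧ G ⊆ F := by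
  have hFE := (h.isFlat hF).subset_ground
  rw [mem_fixedFlats h.finite, mem_fixedFlats (h.restrict hF).finite]
  have key : G ⊆ F → ((M ↾ F).IsFlat G ↔ M.IsFlat G) := by
    intro hG
    rw [Matroid.isFlat_iff_closure_eq, Matroid.isFlat_iff_closure_eq,
      M.restrict_closure_eq hG hFE, Set.inter_eq_self_of_subset_left]
    rw [← (h.isFlat hF).closure]
    exact M.closure_subset_closure hG
  constructor
  · rintro ⟨h1, h2⟩
    have hG : G ⊆ F := h1.subset_ground
    exact ⟨⟨(key hG).1 h1, h2⟩, hG⟩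
  · rintro ⟨⟨h1, h2⟩, hG⟩
    exact ⟨(key hG).2 h1, h2⟩

/-- The fixed flats of `M ／ F` form the interval above `F`, through `K ↦ K ∪ F`. Together with
`mem_restrict_iff` this identifies every interval of the lattice of fixed flats with the fixed flats
of a minor. -/
theorem mem_contract_iff {F K : Set α} (hF : F ∈ fixedFlats M σ) :
    K ∈ fixedFlats (M ／ F) σ ↔ K ∪ F ∈ fixedFlats M σ ∧ Disjoint K F := by
  have hFE := (h.isFlat hF).subset_ground
  rw [mem_fixedFlats h.finite, mem_fixedFlats (h.contract hF).finite]
  have key : Disjoint K F → ((M ／ F).IsFlat K ↔ M.IsFlat (K ∪ F)) := by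
    intro hd
    rw [Matroid.isFlat_iff_closure_eq, Matroid.isFlat_iff_closure_eq, Matroid.contract_closure_eq]
    constructor
    · intro h1
      by_cases hFc : F ⊆ M.closure (K ∪ F)
      · rw [← Set.sdiff_union_of_subset hFc, h1]
      · exact absurd ((M.subset_closure F hFE).trans
          (M.closure_subset_closure Set.subset_union_right)) hFc
    · intro h1
      rw [h1, Set.union_sdiff_right, hd.sdiff_eq_left]
  have key2 : Disjoint K F → (σ '' K = K ↔ σ '' (K ∪ F) = K ∪ F) := by
    intro hd
    rw [Set.image_union, h.image_eq hF]
    refine ⟨fun h1 => by rw [h1], fun h1 => ?_⟩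
    have hd' : Disjoint (σ '' K) F := by
      rw [← h.image_eq hF]
      exact Set.disjoint_image_of_injective σ.injective hd
    have h2 := congrArg (· \ F) h1
    simpa only [Set.union_sdiff_right, hd'.sdiff_eq_left, hd.sdiff_eq_left] using h2
  constructor
  · rintro ⟨h1, h2⟩
    have hd : Disjoint K F := Set.disjoint_of_subset_left h1.subset_ground Set.disjoint_sdiff_left
    exact ⟨⟨(key hd).1 h1, (key2 hd).1 h2⟩, hd⟩
  · rintro ⟨⟨h1, h2⟩, hd⟩
    exact ⟨(key hd).2 h1, (key2 hd).2 h2⟩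

open scoped Classical in
theorem sum_contract {A : Type*} [AddCommMonoid A] {F : Set α} (hF : F ∈ fixedFlats M σ)
    (f : Set α → A) :
    ∑ K ∈ fixedFlats (M ／ F) σ, f K = ∑ G ∈ fixedFlats M σ with F ⊆ G, f (G \ F) := by
  refine Finset.sum_bij' (fun K _ => K ∪ F) (fun G _ => G \ F) ?_ ?_ ?_ ?_ ?_
  · intro K hK
    rw [Finset.mem_filter]
    exact ⟨((h.mem_contract_iff hF).1 hK).1, Set.subset_union_right⟩
  · intro G hG
    rw [Finset.mem_filter] at hG
    rw [h.mem_contract_iff hF, Set.sdiff_union_of_subset hG.2]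
    exact ⟨hG.1, Set.disjoint_sdiff_left⟩
  · intro K hK
    rw [Set.union_sdiff_right, ((h.mem_contract_iff hF).1 hK).2.sdiff_eq_left]
  · intro G hG
    exact Set.sdiff_union_of_subset (Finset.mem_filter.1 hG).2
  · intro K hK
    rw [Set.union_sdiff_right, ((h.mem_contract_iff hF).1 hK).2.sdiff_eq_left]

open scoped Classical in
theorem fixedFlats_restrict {F : Set α} (hF : F ∈ fixedFlats M σ) :
    fixedFlats (M ↾ F) σ = (fixedFlats M σ).filter (· ⊆ F) := by
  ext G
  rw [h.mem_restrict_iff hF, Finset.mem_filter]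

end IsAut

theorem contract_restrict_sdiff {F G : Set α} (hFG : F ⊆ G) :
    (M ／ F) ↾ (G \ F) = (M ↾ G) ／ F :=
  (M.restrict_contract_eq_contract_restrict hFG).symm

theorem contract_contract_sdiff {F G : Set α} (hFG : F ⊆ G) : M ／ F ／ (G \ F) = M ／ G := by
  rw [Matroid.contract_contract, Set.union_sdiff_cancel hFG]

/-! ### Transport along a permutation -/

section Transport

variable {σ' : Equiv.Perm α} (τ : Equiv.Perm α)

theorem isFlat_mapEquiv_image {F : Set α} : (M.mapEquiv τ).IsFlat (τ '' F) ↔ M.IsFlat F := by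
  rw [Matroid.isFlat_iff_closure_eq, Matroid.isFlat_iff_closure_eq, Matroid.mapEquiv_eq_map,
    Matroid.map_closure_eq, Set.preimage_image_eq _ τ.injective,
    Set.image_eq_image τ.injective]

theorem restrict_mapEquiv (F : Set α) : (M.mapEquiv τ) ↾ (τ '' F) = (M ↾ F).mapEquiv τ := by
  refine Matroid.ext_indep rfl fun I _ => ?_
  rw [Matroid.mapEquiv_indep_iff, Matroid.restrict_indep_iff, Matroid.restrict_indep_iff,
    Matroid.mapEquiv_indep_iff]
  conv_rhs => rw [← Set.image_subset_image_iff τ.injective, Equiv.image_symm_image]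

theorem dual_mapEquiv : (M.mapEquiv τ)✶ = M✶.mapEquiv τ := by
  rw [Matroid.mapEquiv_eq_map, Matroid.map_dual, Matroid.mapEquiv_eq_map]

theorem contract_mapEquiv (F : Set α) : (M.mapEquiv τ) ／ (τ '' F) = (M ／ F).mapEquiv τ := by
  have h : (M.mapEquiv τ).E \ (τ '' F) = τ '' (M.E \ F) := (Set.image_sdiff τ.injective _ _).symm
  change ((M.mapEquiv τ)✶ ↾ ((M.mapEquiv τ).E \ (τ '' F)))✶ = _
  rw [h, dual_mapEquiv, restrict_mapEquiv, dual_mapEquiv]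
  rfl

theorem rk_mapEquiv : rk (M.mapEquiv τ) = rk M := by
  rw [rk, Matroid.mapEquiv_eq_map, Matroid.eRank_map, rk]

variable {τ} (hστ : ∀ x, σ' (τ x) = τ (σ x))
include hστ

theorem image_mem_fixedFlats_iff {F : Set α} :
    τ '' F ∈ fixedFlats (M.mapEquiv τ) σ' ↔ F ∈ fixedFlats M σ := by
  by_cases h : M.E.Finite
  · have h' : (M.mapEquiv τ).E.Finite := h.image τ
    have hs : σ' '' (τ '' F) = τ '' (σ '' F) := by
      rw [Set.image_image, Set.image_image]
      simp only [hστ]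
    rw [mem_fixedFlats h, mem_fixedFlats h', isFlat_mapEquiv_image, hs,
      Set.image_eq_image τ.injective]
  · have h' : ¬ (M.mapEquiv τ).E.Finite := fun h' => h (h'.of_finite_image τ.injective.injOn)
    rw [fixedFlats, fixedFlats, dif_neg h, dif_neg h']
    simp

theorem sum_fixedFlats_mapEquiv {A : Type*} [AddCommMonoid A] (f : Set α → A) :
    ∑ F ∈ fixedFlats (M.mapEquiv τ) σ', f F = ∑ F ∈ fixedFlats M σ, f (τ '' F) := by
  refine Finset.sum_bij' (fun F _ => τ.symm '' F) (fun F _ => τ '' F) ?_ ?_ ?_ ?_ ?_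
  · intro F hF
    rwa [← image_mem_fixedFlats_iff hστ, Equiv.image_symm_image]
  · intro F hF
    rwa [image_mem_fixedFlats_iff hστ]
  · intro F _
    exact Equiv.image_symm_image τ F
  · intro F _
    exact Equiv.symm_image_image τ F
  · intro F _
    rw [Equiv.image_symm_image]

end Transport

/-! ### Möbius numbers, characteristic polynomials and Kazhdan–Lusztig polynomials -/

open scoped Classical in
/-- The Möbius number of the lattice of fixed flats. -/
def mo (M : Matroid α) (σ : Equiv.Perm α) : ℂ :=
  if M.E = ∅ then 1 else -∑ F ∈ ((fixedFlats M σ).erase M.E).attach, mo (M ↾ F.1) σ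
termination_by M.E.ncard
decreasing_by
  exact ncard_restrict_lt (Finset.mem_of_mem_erase F.2) (Finset.ne_of_mem_erase F.2)

/-- The characteristic polynomial of the lattice of fixed flats. -/
def cp (M : Matroid α) (σ : Equiv.Perm α) : ℂ[X] :=
  -- The Möbius numbers are those of the fixed flats, but the exponents use ranks in `M`, not
  -- lengths of chains of fixed flats.
  ∑ F ∈ fixedFlats M σ, Polynomial.C (mo (M ↾ F) σ) * Polynomial.X ^ (rk M - rk (M ↾ F))

/-- The part of a polynomial in degrees less than `r / 2`. -/
def lowPart {R : Type*} [Semiring R] (r : ℕ) (q : R[X]) : R[X] :=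
  -- The bound `i < (r + 1) / 2` means `2 * i < r`, for both parities of `r`.
  ∑ i ∈ Finset.range ((r + 1) / 2), Polynomial.monomial i (q.coeff i)

theorem coeff_lowPart {R : Type*} [Semiring R] (r : ℕ) (q : R[X]) (i : ℕ) :
    (lowPart r q).coeff i = if 2 * i < r then q.coeff i else 0 := by
  rw [lowPart, Polynomial.finsetSum_coeff]
  simp only [Polynomial.coeff_monomial]
  rw [Finset.sum_ite_eq' (Finset.range _) i]
  have : i ∈ Finset.range ((r + 1) / 2) ↔ 2 * i < r := by rw [Finset.mem_range]; omega
  simp only [this]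

open scoped Classical in
/-- The Kazhdan–Lusztig polynomial of the lattice of fixed flats. -/
def kl (M : Matroid α) (σ : Equiv.Perm α) : ℂ[X] :=
  -- In the recursion the empty flat contributes the unknown polynomial itself. Below degree `r / 2`
  -- the left side, being reflected, vanishes, so there the unknown is minus the sum over the
  -- nonempty flats.
  if M.E = ∅ then 1 else -lowPart (rk M)
    (∑ F ∈ ((fixedFlats M σ).erase ∅).attach, cp (M ↾ F.1) σ * kl (M ／ F.1) σ)
termination_by M.E.ncard
decreasing_by
  exact ncard_contract_lt (Finset.mem_of_mem_erase F.2) (Finset.ne_of_mem_erase F.2)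

theorem mo_of_empty (h : M.E = ∅) : mo M σ = 1 := by
  rw [mo, if_pos h]

open scoped Classical in
theorem mo_of_ne_empty (h : M.E ≠ ∅) :
    mo M σ = -∑ F ∈ (fixedFlats M σ).erase M.E, mo (M ↾ F) σ := by
  rw [mo, if_neg h, Finset.sum_attach _ fun F => mo (M ↾ F) σ]

theorem kl_of_empty (h : M.E = ∅) : kl M σ = 1 := by
  unfold kl
  rw [if_pos h]

open scoped Classical in
/-- The sum of the terms of the recursion for nonempty flats. -/
def klSum (M : Matroid α) (σ : Equiv.Perm α) : ℂ[X] :=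
  ∑ F ∈ (fixedFlats M σ).erase ∅, cp (M ↾ F) σ * kl (M ／ F) σ

theorem kl_of_ne_empty (h : M.E ≠ ∅) : kl M σ = -lowPart (rk M) (klSum M σ) := by
  classical
  unfold kl
  rw [if_neg h, klSum]
  congr 2
  rw [← Finset.sum_attach ((fixedFlats M σ).erase ∅)]

/-- Together with `cp_mapEquiv` and `kl_mapEquiv`, this gives the invariance under conjugation that
sums over orbits of flats require. -/
theorem mo_mapEquiv {τ σ' : Equiv.Perm α} (hστ : ∀ x, σ' (τ x) = τ (σ x)) (M : Matroid α) :
    mo (M.mapEquiv τ) σ' = mo M σ := by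
  classical
  induction hn : M.E.ncard using Nat.strong_induction_on generalizing M with
  | _ n ih =>
  subst hn
  by_cases h : M.E = ∅
  · rw [mo_of_empty h, mo_of_empty]
    rw [Matroid.mapEquiv_ground_eq, h, Set.image_empty]
  · have h' : (M.mapEquiv τ).E ≠ ∅ := by
      rwa [Matroid.mapEquiv_ground_eq, Ne, Set.image_eq_empty]
    rw [mo_of_ne_empty h, mo_of_ne_empty h', neg_inj, ← Finset.filter_ne', ← Finset.filter_ne',
      Finset.sum_filter, Finset.sum_filter, sum_fixedFlats_mapEquiv hστ]
    refine Finset.sum_congr rfl fun F hF => ?_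
    simp only [Matroid.mapEquiv_ground_eq, ne_eq, Set.image_eq_image τ.injective,
      restrict_mapEquiv]
    split_ifs with h2
    · rfl
    · exact ih _ (ncard_restrict_lt hF h2) _ rfl

theorem cp_mapEquiv {τ σ' : Equiv.Perm α} (hστ : ∀ x, σ' (τ x) = τ (σ x)) (M : Matroid α) :
    cp (M.mapEquiv τ) σ' = cp M σ := by
  rw [cp, sum_fixedFlats_mapEquiv hστ, cp]
  refine Finset.sum_congr rfl fun F _ => ?_
  rw [restrict_mapEquiv, mo_mapEquiv hστ, rk_mapEquiv, rk_mapEquiv]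

theorem kl_mapEquiv {τ σ' : Equiv.Perm α} (hστ : ∀ x, σ' (τ x) = τ (σ x)) (M : Matroid α) :
    kl (M.mapEquiv τ) σ' = kl M σ := by
  classical
  induction hn : M.E.ncard using Nat.strong_induction_on generalizing M with
  | _ n ih =>
  subst hn
  by_cases h : M.E = ∅
  · rw [kl_of_empty h, kl_of_empty]
    rw [Matroid.mapEquiv_ground_eq, h, Set.image_empty]
  · have h' : (M.mapEquiv τ).E ≠ ∅ := by
      rwa [Matroid.mapEquiv_ground_eq, Ne, Set.image_eq_empty]
    rw [kl_of_ne_empty h, kl_of_ne_empty h', rk_mapEquiv, klSum, klSum, ← Finset.filter_ne',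
      ← Finset.filter_ne', Finset.sum_filter, Finset.sum_filter, sum_fixedFlats_mapEquiv hστ]
    congr 2
    refine Finset.sum_congr rfl fun F hF => ?_
    simp only [ne_eq, Set.image_eq_empty, restrict_mapEquiv, contract_mapEquiv, cp_mapEquiv hστ]
    split_ifs with h2
    · rfl
    · rw [ih _ ?_ _ rfl]
      exact ncard_contract_lt hF h2

end FixedFlats

/-! ### The kernel property and the Kazhdan–Lusztig recursion -/

section Kernel

open Polynomial

variable {α : Type v} {M : Matroid α} {σ : Equiv.Perm α}

theorem fixedFlats_of_empty (h : IsAut M σ) (hE : M.E = ∅) : fixedFlats M σ = {∅} := by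
  ext F
  rw [Finset.mem_singleton]
  constructor
  · intro hF
    exact Set.subset_empty_iff.1 (hE ▸ (h.isFlat hF).subset_ground)
  · rintro rfl
    exact h.empty_mem

theorem mo_restrict_empty : mo (M ↾ ∅) σ = 1 := mo_of_empty rfl

theorem rk_of_empty (hE : M.E = ∅) : rk M = 0 := by
  rw [rk, Matroid.eRank_def, hE, Matroid.eRk_empty]
  rfl

theorem cp_of_empty (h : IsAut M σ) (hE : M.E = ∅) : cp M σ = 1 := by
  rw [cp, fixedFlats_of_empty h hE, Finset.sum_singleton, mo_restrict_empty, rk_of_empty hE,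
    Nat.zero_sub, pow_zero, mul_one, C_1]

theorem sum_mo (h : IsAut M σ) :
    ∑ F ∈ fixedFlats M σ, mo (M ↾ F) σ = if M.E = ∅ then 1 else 0 := by
  classical
  split_ifs with hE
  · rw [fixedFlats_of_empty h hE, Finset.sum_singleton, mo_restrict_empty]
  · rw [← Finset.add_sum_erase _ _ h.ground_mem, Matroid.restrict_ground_eq_self,
      mo_of_ne_empty hE, neg_add_cancel]

theorem IsAut.mem_restrict_of_subset (h : IsAut M σ) {F G : Set α} (hF : F ∈ fixedFlats M σ)
    (hG : G ∈ fixedFlats M σ) (hFG : F ⊆ G) : F ∈ fixedFlats (M ↾ G) σ :=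
  (h.mem_restrict_iff hG).2 ⟨hF, hFG⟩

open scoped Classical in
theorem sum_mo_interval (h : IsAut M σ) {F G : Set α} (hF : F ∈ fixedFlats M σ)
    (hG : G ∈ fixedFlats M σ) (hFG : F ⊆ G) :
    ∑ K ∈ fixedFlats M σ with F ⊆ K ∧ K ⊆ G, mo ((M ↾ K) ／ F) σ = if F = G then 1 else 0 := by
  have hF' := h.mem_restrict_of_subset hF hG hFG
  have h1 := sum_mo ((h.restrict hG).contract hF')
  rw [(h.restrict hG).sum_contract hF', h.fixedFlats_restrict hG, Finset.filter_filter] at h1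
  have h2 : ((M ↾ G) ／ F).E = ∅ ↔ F = G := by
    rw [Matroid.contract_ground, Matroid.restrict_ground_eq, Set.sdiff_eq_empty]
    exact ⟨fun h => hFG.antisymm h, fun h => h.ge⟩
  simp only [h2] at h1
  rw [← h1]
  refine Finset.sum_congr (Finset.filter_congr fun K _ => and_comm) fun K hK => ?_
  rw [Finset.mem_filter] at hK
  rw [contract_restrict_sdiff hK.2.2, Matroid.restrict_restrict_eq _ hK.2.1]

-- The Möbius matrix `A` is a left inverse of the zeta matrix `Z` by `sum_mo_interval`. For finite
-- square matrices it is then also a right inverse, which is the sum over the other endpoint.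
open scoped Classical in
theorem sum_mo_interval' (h : IsAut M σ) {F G : Set α} (hF : F ∈ fixedFlats M σ)
    (hG : G ∈ fixedFlats M σ) :
    ∑ K ∈ fixedFlats M σ with F ⊆ K ∧ K ⊆ G, mo ((M ↾ G) ／ K) σ = if F = G then 1 else 0 := by
  let A : Matrix (fixedFlats M σ) (fixedFlats M σ) ℂ :=
    fun F G => if F.1 ⊆ G.1 then mo ((M ↾ G.1) ／ F.1) σ else 0
  let Z : Matrix (fixedFlats M σ) (fixedFlats M σ) ℂ := fun F G => if F.1 ⊆ G.1 then 1 else 0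
  have h1 : A * Z = 1 := by
    ext ⟨F, hF⟩ ⟨G, hG⟩
    rw [Matrix.mul_apply, Matrix.one_apply]
    simp only [A, Z, mul_ite, mul_one, mul_zero, ← ite_and, Subtype.mk.injEq]
    rw [Finset.sum_coe_sort (fixedFlats M σ) fun K =>
      if K ⊆ G ∧ F ⊆ K then mo ((M ↾ K) ／ F) σ else 0, ← Finset.sum_filter]
    by_cases hFG : F ⊆ G
    · rw [← sum_mo_interval h hF hG hFG]
      exact Finset.sum_congr (Finset.filter_congr fun K _ => and_comm) fun _ _ => rfl
    · rw [if_neg fun h => hFG h.le, Finset.sum_eq_zero]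
      intro K hK
      rw [Finset.mem_filter] at hK
      exact absurd (hK.2.2.trans hK.2.1) hFG
  have hZ : Z * A = 1 := mul_eq_one_comm.1 h1
  have h2 := congrFun (congrFun hZ ⟨F, hF⟩) ⟨G, hG⟩
  rw [Matrix.mul_apply, Matrix.one_apply] at h2
  simp only [A, Z, ite_mul, one_mul, zero_mul, ← ite_and, Subtype.mk.injEq] at h2
  rw [Finset.sum_coe_sort (fixedFlats M σ) fun K =>
      if F ⊆ K ∧ K ⊆ G then mo ((M ↾ G) ／ K) σ else 0, ← Finset.sum_filter] at h2
  exact h2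

theorem IsAut.rk_restrict_le (h : IsAut M σ) {F : Set α} (hF : F ∈ fixedFlats M σ) :
    rk (M ↾ F) ≤ rk M := by
  have := h.rk_add hF
  omega

theorem IsAut.rk_restrict_add (h : IsAut M σ) {F G : Set α} (hF : F ∈ fixedFlats M σ)
    (hG : G ∈ fixedFlats M σ) (hFG : F ⊆ G) :
    rk (M ↾ F) + rk ((M ↾ G) ／ F) = rk (M ↾ G) := by
  have := (h.restrict hG).rk_add (h.mem_restrict_of_subset hF hG hFG)
  rwa [Matroid.restrict_restrict_eq _ hFG] at this

theorem natDegree_cp_le : (cp M σ).natDegree ≤ rk M :=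
  natDegree_sum_le_of_forall_le _ _ fun _ _ =>
    (natDegree_C_mul_X_pow_le _ _).trans (Nat.sub_le _ _)

theorem reflect_sum {ι : Type*} (N : ℕ) (s : Finset ι) (f : ι → ℂ[X]) :
    (∑ i ∈ s, f i).reflect N = ∑ i ∈ s, (f i).reflect N := by
  classical
  induction s using Finset.induction_on with
  | empty => simp
  | insert i s hi ih => rw [Finset.sum_insert hi, Finset.sum_insert hi, reflect_add, ih]

theorem reflect_cp (h : IsAut M σ) :
    (cp M σ).reflect (rk M) = ∑ F ∈ fixedFlats M σ, C (mo (M ↾ F) σ) * X ^ rk (M ↾ F) := by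
  rw [cp, reflect_sum]
  refine Finset.sum_congr rfl fun F hF => ?_
  rw [reflect_C_mul_X_pow, revAt_le (Nat.sub_le _ _), Nat.sub_sub_self (h.rk_restrict_le hF)]

open scoped Classical in
theorem reflect_cp_restrict (h : IsAut M σ) {G : Set α} (hG : G ∈ fixedFlats M σ) :
    (cp (M ↾ G) σ).reflect (rk (M ↾ G)) =
      ∑ F ∈ fixedFlats M σ, if F ⊆ G then C (mo (M ↾ F) σ) * X ^ rk (M ↾ F) else 0 := by
  rw [reflect_cp (h.restrict hG), h.fixedFlats_restrict hG, ← Finset.sum_filter]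
  refine Finset.sum_congr rfl fun F hF => ?_
  rw [Matroid.restrict_restrict_eq _ (Finset.mem_filter.1 hF).2]

open scoped Classical in
theorem cp_contract (h : IsAut M σ) {G : Set α} (hG : G ∈ fixedFlats M σ) :
    cp (M ／ G) σ = ∑ K ∈ fixedFlats M σ,
      if G ⊆ K then C (mo ((M ↾ K) ／ G) σ) * X ^ (rk M - rk (M ↾ K)) else 0 := by
  rw [cp, h.sum_contract hG, ← Finset.sum_filter]
  refine Finset.sum_congr rfl fun K hK => ?_
  rw [Finset.mem_filter] at hK
  rw [contract_restrict_sdiff hK.2]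
  have h1 := h.rk_restrict_add hG hK.1 hK.2
  have h2 := h.rk_add hG
  congr 2
  omega

/-- The characteristic polynomials are the kernel of the lattice of fixed flats. -/
theorem sum_reflect_cp_mul_cp (h : IsAut M σ) (hE : M.E ≠ ∅) :
    ∑ G ∈ fixedFlats M σ, (cp (M ↾ G) σ).reflect (rk (M ↾ G)) * cp (M ／ G) σ = 0 := by
  classical
  have h1 : ∀ G ∈ fixedFlats M σ,
      (cp (M ↾ G) σ).reflect (rk (M ↾ G)) * cp (M ／ G) σ =
      ∑ F ∈ fixedFlats M σ, ∑ K ∈ fixedFlats M σ,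
        C (mo (M ↾ F) σ) * X ^ (rk (M ↾ F) + (rk M - rk (M ↾ K))) *
          C (if F ⊆ G ∧ G ⊆ K then mo ((M ↾ K) ／ G) σ else 0) := by
    intro G hG
    rw [reflect_cp_restrict h hG, cp_contract h hG, Finset.sum_mul_sum]
    refine Finset.sum_congr rfl fun F _ => Finset.sum_congr rfl fun K _ => ?_
    by_cases h1 : F ⊆ G
    · by_cases h2 : G ⊆ K
      · rw [if_pos h1, if_pos h2, if_pos ⟨h1, h2⟩, pow_add]
        ring
      · rw [if_neg h2, if_neg (fun h => h2 h.2 : ¬ (F ⊆ G ∧ G ⊆ K)), mul_zero, C_0, mul_zero]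
    · rw [if_neg h1, if_neg (fun h => h1 h.1 : ¬ (F ⊆ G ∧ G ⊆ K)), zero_mul, C_0, mul_zero]
  rw [Finset.sum_congr rfl h1, Finset.sum_comm]
  -- For fixed `F` and `K` the sum over `G` between them is `1` if `F = K` and `0` otherwise. At `K
  -- = F` the exponent is `rk M` whatever `F` is, so what remains is `X ^ rk M` times the sum of all
  -- Möbius numbers, which is zero.
  have h2 : ∀ F ∈ fixedFlats M σ, ∑ G ∈ fixedFlats M σ, ∑ K ∈ fixedFlats M σ,
        C (mo (M ↾ F) σ) * X ^ (rk (M ↾ F) + (rk M - rk (M ↾ K))) *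
          C (if F ⊆ G ∧ G ⊆ K then mo ((M ↾ K) ／ G) σ else 0) =
      C (mo (M ↾ F) σ) * X ^ rk M := by
    intro F hF
    rw [Finset.sum_comm, Finset.sum_eq_single_of_mem F hF]
    · rw [← Finset.mul_sum, ← map_sum, ← Finset.sum_filter, sum_mo_interval' h hF hF, if_pos rfl,
        C_1, mul_one, Nat.add_sub_cancel' (h.rk_restrict_le hF)]
    · intro K hK hne
      rw [← Finset.mul_sum, ← map_sum, ← Finset.sum_filter, sum_mo_interval' h hF hK,
        if_neg hne.symm, C_0, mul_zero]
  rw [Finset.sum_congr rfl h2, ← Finset.sum_mul, ← map_sum, sum_mo h, if_neg hE, C_0, zero_mul]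

/-! ### The recursion and the degree bound for `kl`. -/

theorem coeff_kl (hE : M.E ≠ ∅) (i : ℕ) :
    (kl M σ).coeff i = if 2 * i < rk M then -(klSum M σ).coeff i else 0 := by
  rw [kl_of_ne_empty hE, coeff_neg, coeff_lowPart]
  split_ifs <;> simp

theorem coeff_kl_eq_zero (hE : M.E ≠ ∅) {i : ℕ} (hi : rk M ≤ 2 * i) : (kl M σ).coeff i = 0 := by
  rw [coeff_kl hE, if_neg hi.not_gt]

theorem two_mul_natDegree_kl_le : 2 * (kl M σ).natDegree ≤ rk M := by
  by_cases hE : M.E = ∅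
  · rw [kl_of_empty hE, natDegree_one]
    exact Nat.zero_le _
  · by_contra h
    push Not at h
    have h1 := coeff_kl_eq_zero (σ := σ) hE h.le
    rw [coeff_natDegree, leadingCoeff_eq_zero] at h1
    rw [h1] at h
    simp at h

theorem natDegree_klSum_le (h : IsAut M σ) : (klSum M σ).natDegree ≤ rk M := by
  classical
  refine natDegree_sum_le_of_forall_le _ _ fun F hF => natDegree_mul_le.trans ?_
  have h1 := h.rk_add (Finset.mem_of_mem_erase hF)
  have h2 := natDegree_cp_le (M := M ↾ F) (σ := σ)
  have h3 := two_mul_natDegree_kl_le (M := M ／ F) (σ := σ)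
  omega

/-- A polynomial that is antisymmetric with respect to `t ↦ t^r p(t⁻¹)` is determined by its
part in degrees less than `r / 2`. -/
theorem reflect_lowPart {r : ℕ} {q : ℂ[X]} (hd : q.natDegree ≤ r) (hq : q.reflect r = -q) :
    (-lowPart r q).reflect r = -lowPart r q + q := by
  ext j
  rw [coeff_reflect, coeff_add, coeff_neg, coeff_neg, coeff_lowPart, coeff_lowPart]
  have hc := congrArg (coeff · j) hq
  simp only [coeff_reflect, coeff_neg] at hc
  by_cases hj : j ≤ r
  · rw [revAt_le hj] at hc ⊢
    by_cases h1 : 2 * j < r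
    · rw [if_pos h1, if_neg (by omega)]
      ring
    · by_cases h2 : 2 * j = r
      · have h3 : r - j = j := by omega
        rw [h3] at hc ⊢
        -- In the middle degree antisymmetry reads `q_j = -q_j`.
        have : q.coeff j = 0 := by linear_combination hc / 2
        rw [if_neg h1, this, neg_zero, add_zero]
      · rw [if_neg h1, if_pos (by omega), hc]
        ring
  · have h0 : q.coeff j = 0 := coeff_eq_zero_of_natDegree_lt (by omega)
    -- Beyond degree `r`, `reflect` leaves coefficients in place, and those of `q` vanish there.
    have h1 : revAt r j = j := by
      rw [← revAtFun_eq, revAtFun, if_neg hj]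
    rw [h1, h0, if_neg (by omega)]
    simp

theorem contract_empty_eq : M ／ ∅ = M := Matroid.contract_eq_self_iff.2 (Set.empty_disjoint _)

-- This is the kernel identity for `M ↾ G` with the term of the empty flat, which equals `cp (M ↾ G)
-- σ`, moved to the other side.
open scoped Classical in
theorem sum_erase_empty_reflect (h : IsAut M σ) {G : Set α} (hG : G ∈ fixedFlats M σ)
    (hne : G ≠ ∅) :
    ∑ F ∈ (fixedFlats M σ).erase ∅,
      (if F ⊆ G then (cp (M ↾ F) σ).reflect (rk (M ↾ F)) * cp ((M ↾ G) ／ F) σ else 0) =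
      -cp (M ↾ G) σ := by
  have h1 := sum_reflect_cp_mul_cp (h.restrict hG) hne
  rw [h.fixedFlats_restrict hG, Finset.sum_filter, ← Finset.add_sum_erase _ _ h.empty_mem,
    if_pos (Set.empty_subset _), contract_empty_eq] at h1
  have h2 : cp (M ↾ G ↾ ∅) σ = 1 := by
    rw [Matroid.restrict_restrict_eq _ (Set.empty_subset _)]
    exact cp_of_empty (h.restrict h.empty_mem) rfl
  rw [h2, ← C_1, reflect_C, C_1, one_mul, rk_of_empty (M := M ↾ G ↾ ∅) rfl, pow_zero,
    one_mul] at h1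
  rw [← eq_neg_of_add_eq_zero_right h1]
  refine Finset.sum_congr rfl fun F _ => ?_
  split_ifs with hFG
  · rw [Matroid.restrict_restrict_eq _ hFG]
  · rfl

-- Reflecting a term of `klSum` and expanding its factor `kl` by the recursion for `M ／ F` gives a
-- double sum over `F ⊆ G`. After exchanging the sums, the inner one over `F` collapses to `-cp (M ↾
-- G) σ` by `sum_erase_empty_reflect`.
open scoped Classical in
theorem reflect_klSum (h : IsAut M σ)
    (ih : ∀ F ∈ fixedFlats M σ, F ≠ ∅ → (kl (M ／ F) σ).reflect (rk (M ／ F)) =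
      ∑ G ∈ fixedFlats (M ／ F) σ, cp ((M ／ F) ↾ G) σ * kl (M ／ F ／ G) σ) :
    (klSum M σ).reflect (rk M) = -klSum M σ := by
  have h1 : ∀ F ∈ (fixedFlats M σ).erase ∅,
      (cp (M ↾ F) σ * kl (M ／ F) σ).reflect (rk M) =
      ∑ G ∈ (fixedFlats M σ).erase ∅, (if F ⊆ G then
        (cp (M ↾ F) σ).reflect (rk (M ↾ F)) * cp ((M ↾ G) ／ F) σ else 0) * kl (M ／ G) σ := by
    intro F hF
    rw [Finset.mem_erase] at hF
    have hd := two_mul_natDegree_kl_le (M := M ／ F) (σ := σ)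
    rw [← h.rk_add hF.2, reflect_mul _ _ natDegree_cp_le (by omega), ih F hF.2 hF.1,
      h.sum_contract hF.2, Finset.mul_sum, Finset.sum_filter,
      ← Finset.add_sum_erase _ _ h.empty_mem,
      if_neg (fun h => hF.1 (Set.subset_empty_iff.1 h)), zero_add]
    refine Finset.sum_congr rfl fun G _ => ?_
    split_ifs with hFG
    · rw [contract_restrict_sdiff hFG, contract_contract_sdiff hFG, mul_assoc]
    · rw [zero_mul]
  rw [klSum, reflect_sum, Finset.sum_congr rfl h1, Finset.sum_comm, ← Finset.sum_neg_distrib]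
  refine Finset.sum_congr rfl fun G hG => ?_
  rw [Finset.mem_erase] at hG
  rw [← Finset.sum_mul, sum_erase_empty_reflect h hG.2 hG.1, neg_mul]

theorem sum_cp_mul_kl (h : IsAut M σ) :
    ∑ F ∈ fixedFlats M σ, cp (M ↾ F) σ * kl (M ／ F) σ = kl M σ + klSum M σ := by
  classical
  rw [klSum, ← Finset.add_sum_erase _ _ h.empty_mem, cp_of_empty (h.restrict h.empty_mem) rfl,
    contract_empty_eq, one_mul]

theorem reflect_kl (h : IsAut M σ) :
    (kl M σ).reflect (rk M) = ∑ F ∈ fixedFlats M σ, cp (M ↾ F) σ * kl (M ／ F) σ := by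
  classical
  induction hn : M.E.ncard using Nat.strong_induction_on generalizing M with
  | _ n ih =>
  subst hn
  by_cases hE : M.E = ∅
  · rw [fixedFlats_of_empty h hE, Finset.sum_singleton, contract_empty_eq, kl_of_empty hE,
      cp_of_empty (h.restrict h.empty_mem) rfl, rk_of_empty hE, ← C_1, reflect_C, pow_zero, C_1]
  · rw [sum_cp_mul_kl h, kl_of_ne_empty hE]
    exact reflect_lowPart (natDegree_klSum_le h)
      (reflect_klSum h fun F hF hne => ih _ (ncard_contract_lt hF hne) (h.contract hF) rfl)

/-- The Kazhdan–Lusztig polynomial is determined by the recursion and the bound on its degree. -/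
theorem eq_kl_of_reflect (hE : M.E ≠ ∅) {p : ℂ[X]}
    (hd : 2 * p.natDegree < rk M) (hp : p.reflect (rk M) = p + klSum M σ) : p = kl M σ := by
  ext i
  rw [coeff_kl hE]
  split_ifs with hi
  · have hc := congrArg (coeff · i) hp
    simp only [coeff_reflect, coeff_add] at hc
    -- As `2 * i < rk M`, the reflected index `rk M - i` lies above the degree of `p`.
    rw [revAt_le (by omega), coeff_eq_zero_of_natDegree_lt (n := rk M - i) (by omega)] at hc
    linear_combination -hc
  · exact coeff_eq_zero_of_natDegree_lt (by omega)

end Kernel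

/-! ### Values of graded virtual representations at group elements -/

section Evaluation

open Polynomial

variable {W : Type u} [Group W] {W' : Type u} [Group W']

/-- Evaluation of a graded virtual character at an element of the group. -/
def ev (w : W) : (VRep W)[X] →+* ℂ[X] :=
  mapRingHom ((Pi.evalRingHom (fun _ : W => ℂ) w).comp (VRep W).subtype)

theorem coeff_ev (w : W) (p : (VRep W)[X]) (i : ℕ) :
    (ev w p).coeff i = (p.coeff i : W → ℂ) w := by
  rw [ev, coe_mapRingHom, coeff_map]
  rfl

theorem ev_ext {p q : (VRep W)[X]} (h : ∀ w, ev w p = ev w q) : p = q := by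
  refine Polynomial.ext fun i => Subtype.ext (funext fun w => ?_)
  rw [← coeff_ev, ← coeff_ev, h]

theorem ev_C (w : W) (a : VRep W) : ev w (C a) = C ((a : W → ℂ) w) := by
  rw [ev, coe_mapRingHom, map_C]
  rfl

theorem ev_X (w : W) : ev w X = X := by
  rw [ev, coe_mapRingHom, map_X]

theorem ev_reflect (w : W) (p : (VRep W)[X]) (N : ℕ) :
    ev w (p.reflect N) = (ev w p).reflect N := by
  ext i
  simp only [coeff_ev, coeff_reflect]

theorem ev_lowPart (w : W) (p : (VRep W)[X]) (r : ℕ) :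
    ev w (lowPart r p) = lowPart r (ev w p) := by
  ext i
  simp only [coeff_ev, coeff_lowPart]
  split_ifs <;> rfl

theorem ev_map_res (φ : W' →* W) (w : W') (p : (VRep W)[X]) :
    ev w (p.map (res φ)) = ev (φ w) p := by
  ext i
  rw [coeff_ev, coeff_ev, coeff_map]
  rfl

/-- Virtual characters are class functions. -/
theorem VRep_conj (f : VRep W) (g w : W) : (f : W → ℂ) (g * w * g⁻¹) = (f : W → ℂ) w := by
  suffices h : ∀ x ∈ AddSubgroup.closure (characters W), x (g * w * g⁻¹) = x w from h _ f.2
  intro x hx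
  induction hx using AddSubgroup.closure_induction with
  | mem x hx =>
    obtain ⟨n, ρ, rfl⟩ := hx
    exact ρ.char_conj w g
  | zero => rfl
  | add x y _ _ hx hy => rw [Pi.add_apply, Pi.add_apply, hx, hy]
  | neg x _ hx => rw [Pi.neg_apply, Pi.neg_apply, hx]

theorem ev_conj (p : (VRep W)[X]) (g w : W) : ev (g * w * g⁻¹) p = ev w p := by
  ext i
  rw [coeff_ev, coeff_ev, VRep_conj]

theorem coeff_indPoly [Finite W] (H : Subgroup W) (p : (VRep H)[X]) (i : ℕ) :
    (indPoly H p).coeff i = ind H (p.coeff i) := by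
  rw [indPoly, Polynomial.sum, finsetSum_coeff]
  simp only [coeff_monomial]
  rw [Finset.sum_ite_eq' p.support i]
  split_ifs with h
  · rfl
  · rw [notMem_support_iff.1 h, map_zero]

end Evaluation

namespace EquivariantMatroid

open Polynomial

variable {W : Type u} [Group W] {α : Type v} (X : EquivariantMatroid W α)

theorem isAut (w : W) : IsAut X.M (X.act w) := ⟨X.finite, X.loopless, X.preserves w⟩

theorem rank_eq_rk : X.rank = rk X.M := rfl

theorem flatRank_eq_rk (F : X.Flat) : X.flatRank F = rk (X.M ↾ F.1) := rfl

theorem smul_eq_iff {w : W} {F : X.Flat} : w • F = F ↔ X.act w '' F.1 = F.1 := Subtype.ext_iff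

theorem mem_fixedFlats_iff (w : W) (F : X.Flat) :
    F.1 ∈ fixedFlats X.M (X.act w) ↔ w • F = F := by
  rw [mem_fixedFlats X.finite, smul_eq_iff]
  exact and_iff_right F.2

open scoped Classical in
theorem sum_flat {A : Type*} [AddCommMonoid A] [Fintype X.Flat] (w : W) (f : Set α → A) :
    ∑ F : X.Flat with w • F = F, f F.1 = ∑ F ∈ fixedFlats X.M (X.act w), f F := by
  refine Finset.sum_bij (fun F _ => F.1) ?_ ?_ ?_ ?_
  · intro F hF
    exact (X.mem_fixedFlats_iff w F).2 (Finset.mem_filter.1 hF).2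
  · intro F _ G _ h
    exact Subtype.ext h
  · intro F hF
    exact ⟨⟨F, (X.isAut w).isFlat hF⟩,
      Finset.mem_filter.2 ⟨Finset.mem_univ _, (X.mem_fixedFlats_iff w _).1 hF⟩, rfl⟩
  · intro F _
    rfl

open scoped Classical in
theorem osTrace_eq_sum_of_forall {g : Set α → ℂ} (p : ℕ) (w : W)
    (hg : ∀ (F : X.Flat) (h : w • F = F), X.flatRank F = p →
      (X.localize F).osTrace p ⟨w, h⟩ = g F.1) :
    X.osTrace p w = ∑ F ∈ fixedFlats X.M (X.act w) with rk (X.M ↾ F) = p, g F := by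
  have := Fintype.ofFinite X.Flat
  rw [X.osTrace_eq_sum, Finset.sum_filter, Finset.sum_filter, ← X.sum_flat, Finset.sum_filter]
  refine Finset.sum_congr rfl fun F _ => ?_
  rw [flatRank_eq_rk]
  by_cases h : w • F = F
  · rw [dif_pos h, if_pos h]
    split_ifs with hp
    · exact hg F h hp
    · rfl
  · rw [dif_neg h, if_neg h, ite_self]

open scoped Classical in
/-- The top degree part of the Orlik–Solomon algebra computes the Möbius number. -/
theorem neg_one_pow_mul_osTrace_rank (w : W) :
    (-1) ^ X.rank * X.osTrace X.rank w = mo X.M (X.act w) := by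
  induction hn : X.M.E.ncard using Nat.strong_induction_on generalizing W with
  | _ n ih =>
  subst hn
  have hX := X.isAut w
  by_cases hE : X.M.E = ∅
  · rw [rank_eq_rk, rk_of_empty hE, X.osTrace_zero_of_ground_eq_empty hE, mo_of_empty hE,
      pow_zero, one_mul]
  obtain ⟨a, ha⟩ := Set.nonempty_iff_ne_empty.2 hE
  -- The induction hypothesis covers proper flats only; at the full flat `g` keeps the unknown
  -- trace.
  let g : Set α → ℂ := fun F => if F = X.M.E then X.osTrace X.rank w else
    (-1) ^ rk (X.M ↾ F) * mo (X.M ↾ F) (X.act w)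
  have h1 (F : X.Flat) (h : w • F = F) (hne : F.1 ≠ X.M.E) :
      (X.localize F).osTrace (X.flatRank F) ⟨w, h⟩ = g F.1 := by
    have h2 := ih _ (ncard_restrict_lt ((X.mem_fixedFlats_iff w F).2 h) hne)
      (X.localize F) ⟨w, h⟩ rfl
    change (-1) ^ X.flatRank F * (X.localize F).osTrace (X.flatRank F) ⟨w, h⟩ =
      mo (X.M ↾ F.1) (X.act w) at h2
    simp only [g, if_neg hne]
    rw [← h2, ← mul_assoc, ← flatRank_eq_rk, ← mul_pow]
    simp
  have hg (p : ℕ) (F : X.Flat) (h : w • F = F) (hF : X.flatRank F = p) :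
      (X.localize F).osTrace p ⟨w, h⟩ = g F.1 := by
    subst hF
    by_cases hne : F.1 = X.M.E
    · have := Fintype.ofFinite X.Flat
      have hF : X.flatRank F = X.rank := by
        rw [flatRank_eq_rk, hne, Matroid.restrict_ground_eq_self, rank_eq_rk]
      simp only [g, if_pos hne]
      -- In top degree the decomposition has the full flat as its only fixed summand. This compares
      -- the trace of the localization there, a representation of a stabilizer, with that of `X`.
      rw [X.osTrace_eq_sum X.rank w, Finset.sum_eq_single_of_mem F
        (Finset.mem_filter.2 ⟨Finset.mem_univ _, hF⟩), dif_pos h, hF]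
      intro G hG hGF
      by_cases hw : w • G = G
      · have h3 := hX.rk_restrict_lt ((X.mem_fixedFlats_iff w G).2 hw) fun h5 =>
          hGF (Subtype.ext (h5.trans hne.symm))
        exact absurd (Finset.mem_filter.1 hG).2 h3.ne
      · exact dif_neg hw
    · exact h1 F h hne
  -- Regrouped by fixed flats, the vanishing alternating sum is the defining recursion of `mo`.
  have h0 := X.sum_neg_one_pow_mul_osTrace ⟨a, ha⟩ w
  simp only [fun p => X.osTrace_eq_sum_of_forall p w (hg p), Finset.sum_filter,
    Finset.mul_sum] at h0
  rw [Finset.sum_comm] at h0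
  have h4 : ∀ F ∈ fixedFlats X.M (X.act w), (∑ p ∈ Finset.range (X.rank + 1),
      (-1) ^ p * if rk (X.M ↾ F) = p then g F else 0) = (-1) ^ rk (X.M ↾ F) * g F := by
    intro F hF
    simp only [mul_ite, mul_zero]
    rw [Finset.sum_ite_eq, if_pos]
    rw [Finset.mem_range, Nat.lt_succ_iff]
    exact hX.rk_restrict_le hF
  rw [Finset.sum_congr rfl h4, ← Finset.add_sum_erase _ _ hX.ground_mem,
    Matroid.restrict_ground_eq_self] at h0
  rw [mo_of_ne_empty hE, eq_neg_iff_add_eq_zero, ← h0]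
  congr 1
  · simp [g, rank_eq_rk]
  · refine Finset.sum_congr rfl fun F hF => ?_
    simp only [g, if_neg (Finset.ne_of_mem_erase hF)]
    rw [← mul_assoc, ← mul_pow]
    simp

open scoped Classical in
theorem osTrace_eq_sum_mo (p : ℕ) (w : W) :
    X.osTrace p w = ∑ F ∈ fixedFlats X.M (X.act w) with rk (X.M ↾ F) = p,
      (-1) ^ p * mo (X.M ↾ F) (X.act w) := by
  refine X.osTrace_eq_sum_of_forall p w fun F h hF => ?_
  have h2 := (X.localize F).neg_one_pow_mul_osTrace_rank ⟨w, h⟩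
  change (-1) ^ X.flatRank F * (X.localize F).osTrace (X.flatRank F) ⟨w, h⟩ =
    mo (X.M ↾ F.1) (X.act w) at h2
  subst hF
  rw [← h2, ← mul_assoc, ← mul_pow]
  simp

theorem ev_charPoly_eq_sum (w : W) : ev w X.charPoly =
    ∑ p ∈ Finset.range (X.rank + 1),
      C ((-1) ^ p * X.osTrace p w) * Polynomial.X ^ (X.rank - p) := by
  rw [charPoly, map_sum]
  refine Finset.sum_congr rfl fun p _ => ?_
  rw [map_mul, map_pow, ev_C, ev_X]
  rfl

/-- The equivariant characteristic polynomial is given by the lattices of fixed flats. -/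
theorem ev_charPoly (w : W) : ev w X.charPoly = cp X.M (X.act w) := by
  classical
  rw [ev_charPoly_eq_sum, cp]
  have h1 : ∀ p ∈ Finset.range (X.rank + 1),
      C ((-1) ^ p * X.osTrace p w) * Polynomial.X ^ (X.rank - p) =
      ∑ F ∈ fixedFlats X.M (X.act w), if rk (X.M ↾ F) = p then
        C (mo (X.M ↾ F) (X.act w)) * Polynomial.X ^ (rk X.M - p) else 0 := by
    intro p _
    rw [osTrace_eq_sum_mo, Finset.sum_filter, Finset.mul_sum, map_sum, Finset.sum_mul]
    refine Finset.sum_congr rfl fun F _ => ?_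
    split_ifs
    · rw [← mul_assoc, ← mul_pow, rank_eq_rk]
      simp
    · simp
  rw [Finset.sum_congr rfl h1, Finset.sum_comm]
  refine Finset.sum_congr rfl fun F hF => ?_
  rw [Finset.sum_ite_eq, if_pos]
  rw [Finset.mem_range, Nat.lt_succ_iff]
  exact (X.isAut w).rk_restrict_le hF

/-! ### Induction from the stabilizers of flats -/

theorem card_smul_eq (R : X.Flat) (g₀ : W) :
    Nat.card {g : W // g • R = g₀ • R} = Nat.card (X.stab R) := by
  refine Nat.card_congr
    { toFun := fun g => ⟨g₀⁻¹ * g.1, ?_⟩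
      invFun := fun v => ⟨g₀ * v.1, ?_⟩
      left_inv := fun g => Subtype.ext (mul_inv_cancel_left _ _)
      right_inv := fun v => Subtype.ext (inv_mul_cancel_left _ _) }
  · rw [MulAction.mem_stabilizer_iff, mul_smul, g.2, inv_smul_smul]
  · rw [mul_smul, v.2]

-- By the orbit-stabilizer principle each flat in the orbit of `R` is `g • R` for exactly `|W_R|`
-- elements `g`.
open scoped Classical in
theorem inv_card_mul_sum_smul [Fintype W] [Fintype X.Flat] (R : X.Flat) (ψ : X.Flat → ℂ) :
    (Nat.card (X.stab R) : ℂ)⁻¹ * ∑ g : W, ψ (g • R) =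
      ∑ F : X.Flat with (Quotient.mk _ F : X.FlatOrbit) = Quotient.mk _ R, ψ F := by
  have hc : (Nat.card (X.stab R) : ℂ) ≠ 0 := Nat.cast_ne_zero.2 Nat.card_pos.ne'
  rw [inv_mul_eq_iff_eq_mul₀ hc, ← Finset.sum_fiberwise Finset.univ fun g => g • R,
    Finset.mul_sum, Finset.sum_filter]
  refine Finset.sum_congr rfl fun F _ => ?_
  have h1 : ∑ g : W with g • R = F, ψ (g • R) = (Nat.card {g : W // g • R = F} : ℂ) * ψ F := by
    rw [Finset.sum_congr rfl fun g hg => congrArg ψ (Finset.mem_filter.1 hg).2, Finset.sum_const,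
      nsmul_eq_mul, Nat.card_eq_fintype_card, Fintype.card_subtype]
  rw [h1]
  split_ifs with h
  · obtain ⟨g₀, hg₀⟩ : ∃ g₀ : W, g₀ • R = F := Quotient.exact h
    rw [← hg₀, card_smul_eq]
  · have : IsEmpty {g : W // g • R = F} :=
      ⟨fun g => h (Quotient.sound (s := MulAction.orbitRel W X.Flat) ⟨g.1, g.2⟩)⟩
    rw [Nat.card_of_isEmpty, Nat.cast_zero, zero_mul]

/-- Summation of induced class functions over the orbits of flats. -/
theorem sum_indFun [Finite W] {rep : X.FlatOrbit → X.Flat} (hrep : X.IsRepChoice rep)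
    (f : ∀ F : X.Flat, X.stab F → ℂ) (h : Set α → W → ℂ)
    (hf : ∀ (F : X.Flat) (v : X.stab F), f F v = h F.1 v)
    (hc : ∀ (F : Set α) (g w : W), h (X.act g '' F) (g * w * g⁻¹) = h F w) (w : W) :
    ∑ o : X.FlatOrbit, indFun (X.stab (rep o)) (f (rep o)) w =
      ∑ F ∈ fixedFlats X.M (X.act w), h F w := by
  classical
  have := Fintype.ofFinite W
  have := Fintype.ofFinite X.Flat
  let ψ : X.Flat → ℂ := fun F => if w • F = F then h F.1 w else 0
  have h1 (R : X.Flat) : indFun (X.stab R) (f R) w =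
      ∑ F : X.Flat with (Quotient.mk _ F : X.FlatOrbit) = Quotient.mk _ R, ψ F := by
    rw [← inv_card_mul_sum_smul, indFun, finsum_eq_sum_of_fintype]
    congr 1
    refine Finset.sum_congr rfl fun g _ => ?_
    -- The term of `g` in the induced character is nonzero only if `w` fixes `g • R`, so it is a
    -- function of the flat `g • R`.
    have hm : g⁻¹ * w * g ∈ X.stab R ↔ w • g • R = g • R := by
      rw [MulAction.mem_stabilizer_iff, mul_smul, mul_smul, inv_smul_eq_iff]
    by_cases hg : w • g • R = g • R
    · rw [dif_pos (hm.2 hg), hf]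
      simp only [ψ, if_pos hg]
      rw [← hc R.1 g]
      congr 1
      group
    · rw [dif_neg (mt hm.1 hg)]
      simp only [ψ, if_neg hg]
  rw [← X.sum_flat w fun F => h F w, Finset.sum_filter]
  rw [← Finset.sum_fiberwise Finset.univ fun F : X.Flat => (Quotient.mk _ F : X.FlatOrbit)]
  refine Finset.sum_congr rfl fun o _ => ?_
  rw [h1, hrep o]

/-- This turns the equivariant recursion into one on the fixed flats of a single `w`. The family `h`
makes terms over different stabilizers comparable, and `hc` makes the result independent of
representatives. -/
theorem ev_sum_indPoly [Finite W] {rep : X.FlatOrbit → X.Flat} (hrep : X.IsRepChoice rep)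
    (f : ∀ F : X.Flat, (VRep (X.stab F))[X]) (h : Set α → W → ℂ[X])
    (hf : ∀ (F : X.Flat) (v : X.stab F), ev v (f F) = h F.1 v)
    (hc : ∀ (F : Set α) (g w : W), h (X.act g '' F) (g * w * g⁻¹) = h F w) (w : W) :
    ev w (∑ o : X.FlatOrbit, indPoly (X.stab (rep o)) (f (rep o))) =
      ∑ F ∈ fixedFlats X.M (X.act w), h F w := by
  ext i
  rw [map_sum, finsetSum_coeff, finsetSum_coeff]
  rw [← X.sum_indFun hrep (fun F => ((f F).coeff i : X.stab F → ℂ)) (fun F w => (h F w).coeff i)]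
  · refine Finset.sum_congr rfl fun o _ => ?_
    rw [coeff_ev, coeff_indPoly]
    rfl
  · intro F v
    rw [← coeff_ev, hf]
  · intro F g w
    rw [hc]

theorem restrict_image (g : W) (F : Set α) :
    X.M ↾ (X.act g '' F) = (X.M ↾ F).mapEquiv (X.act g) := by
  rw [← restrict_mapEquiv, X.preserves]

theorem contract_image (g : W) (F : Set α) :
    X.M ／ (X.act g '' F) = (X.M ／ F).mapEquiv (X.act g) := by
  rw [← contract_mapEquiv, X.preserves]

theorem act_conj (g w : W) (x : α) : X.act (g * w * g⁻¹) (X.act g x) = X.act g (X.act w x) := by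
  simp [← Equiv.Perm.mul_apply, ← map_mul]

theorem cp_image (g w : W) (F : Set α) :
    cp (X.M ↾ (X.act g '' F)) (X.act (g * w * g⁻¹)) = cp (X.M ↾ F) (X.act w) := by
  rw [restrict_image, cp_mapEquiv (X.act_conj g w)]

theorem kl_image (g w : W) (F : Set α) :
    kl (X.M ／ (X.act g '' F)) (X.act (g * w * g⁻¹)) = kl (X.M ／ F) (X.act w) := by
  rw [contract_image, kl_mapEquiv (X.act_conj g w)]

theorem rk_restrict_image (g : W) (F : Set α) : rk (X.M ↾ (X.act g '' F)) = rk (X.M ↾ F) := by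
  rw [restrict_image, rk_mapEquiv]

end EquivariantMatroid

/-! ### The first two coefficients -/

section Coefficients

open Polynomial

variable {α : Type v} {M : Matroid α} {σ : Equiv.Perm α}

theorem coeff_cp_rk (h : IsAut M σ) : (cp M σ).coeff (rk M) = 1 := by
  rw [cp, finsetSum_coeff, Finset.sum_eq_single_of_mem ∅ h.empty_mem]
  · rw [mo_restrict_empty, rk_of_empty (M := M ↾ ∅) rfl, coeff_C_mul_X_pow, Nat.sub_zero,
      if_pos rfl]
  · intro F hF hne
    rw [coeff_C_mul_X_pow, if_neg]
    have h1 : rk (M ↾ F) ≠ 0 := by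
      rw [Ne, rk_eq_zero_iff (h.restrict hF).finite (h.restrict hF).loopless]
      exact hne
    have h2 := h.rk_restrict_le hF
    omega

theorem IsAut.contract_ne_empty (h : IsAut M σ) {F : Set α} (hF : F ∈ fixedFlats M σ)
    (hne : F ≠ M.E) : (M ／ F).E ≠ ∅ := fun h3 =>
  hne ((h.isFlat hF).subset_ground.antisymm (Set.sdiff_eq_empty.1 h3))

theorem two_mul_natDegree_kl_lt (h : IsAut M σ) (hE : M.E ≠ ∅) :
    2 * (kl M σ).natDegree < rk M := by
  by_contra hd
  push Not at hd
  have h1 := coeff_kl_eq_zero (σ := σ) hE hd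
  rw [coeff_natDegree, leadingCoeff_eq_zero] at h1
  rw [h1, natDegree_zero, mul_zero, Nat.le_zero, rk_eq_zero_iff h.finite h.loopless] at hd
  exact hE hd

theorem kl_contract_ground : kl (M ／ M.E) σ = 1 := kl_of_empty (Set.sdiff_self)

/-- Compare coefficients of `t ^ rk M` in the recursion: for a proper flat the factors have degrees
at most `rk F` and less than half the corank, so only the full flat reaches that degree. -/
theorem coeff_zero_kl (h : IsAut M σ) : (kl M σ).coeff 0 = 1 := by
  have h1 := congrArg (coeff · (rk M)) (reflect_kl h)
  simp only [coeff_reflect, finsetSum_coeff] at h1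
  rw [revAt_le le_rfl, Nat.sub_self] at h1
  rw [h1, Finset.sum_eq_single_of_mem M.E h.ground_mem]
  · rw [kl_contract_ground, mul_one, Matroid.restrict_ground_eq_self, coeff_cp_rk h]
  · intro F hF hne
    have h2 := h.rk_add hF
    have h3 := natDegree_cp_le (M := M ↾ F) (σ := σ)
    have h4 := two_mul_natDegree_kl_lt (h.contract hF) (h.contract_ne_empty hF hne)
    exact coeff_eq_zero_of_natDegree_lt (natDegree_mul_le.trans_lt (by omega))

/-- In corank `c` the product has degree less than `rk M - c / 2`, which leaves room for degree `rk
M - 1` only if `c = 1`; then `kl (M ／ F) σ` is the constant `1`. -/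
theorem coeff_cp_mul_kl (h : IsAut M σ) {F : Set α} (hF : F ∈ fixedFlats M σ) (hne : F ≠ M.E) :
    (cp (M ↾ F) σ * kl (M ／ F) σ).coeff (rk M - 1) =
      if rk (M ↾ F) + 1 = rk M then 1 else 0 := by
  have h2 := h.rk_add hF
  have h3 := natDegree_cp_le (M := M ↾ F) (σ := σ)
  have h4 := two_mul_natDegree_kl_lt (h.contract hF) (h.contract_ne_empty hF hne)
  split_ifs with h5
  · have h6 : (kl (M ／ F) σ).natDegree = 0 := by omega
    rw [eq_C_of_natDegree_eq_zero h6, coeff_zero_kl (h.contract hF), C_1, mul_one, ← h5,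
      Nat.add_sub_cancel, coeff_cp_rk (h.restrict hF)]
  · exact coeff_eq_zero_of_natDegree_lt (natDegree_mul_le.trans_lt (by omega))

theorem coeff_one_kl (h : IsAut M σ) (hE : M.E ≠ ∅) : (kl M σ).coeff 1 =
    (∑ F ∈ fixedFlats M σ, if rk (M ↾ F) + 1 = rk M then 1 else 0) +
      (cp M σ).coeff (rk M - 1) := by
  classical
  have hr : rk M ≠ 0 := by rwa [Ne, rk_eq_zero_iff h.finite h.loopless]
  have h1 := congrArg (coeff · (rk M - 1)) (reflect_kl h)
  simp only [coeff_reflect, finsetSum_coeff] at h1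
  rw [revAt_le (Nat.sub_le _ _), Nat.sub_sub_self (Nat.one_le_iff_ne_zero.2 hr)] at h1
  rw [h1, ← Finset.add_sum_erase _ _ h.ground_mem, ← Finset.add_sum_erase _ _ h.ground_mem,
    kl_contract_ground, mul_one, Matroid.restrict_ground_eq_self, if_neg (by omega), zero_add,
    add_comm]
  congr 1
  refine Finset.sum_congr rfl fun F hF => ?_
  exact coeff_cp_mul_kl h (Finset.mem_of_mem_erase hF) (Finset.ne_of_mem_erase hF)

end Coefficients

/-! ### Existence and uniqueness -/

section Main

open Polynomial

theorem EquivariantMatroid.ext' {W : Type u} [Group W] {α : Type v}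
    {X Y : EquivariantMatroid W α} (hM : X.M = Y.M) (ha : X.act = Y.act) : X = Y := by
  cases X
  cases Y
  cases hM
  cases ha
  rfl

variable {W : Type u} [Group W] {α : Type v}

/-- The term of the empty flat in the recursion belongs to the stabilizer, formally a different
group. Compatibility with pull-back identifies it with the unknown polynomial of `X` itself. -/
theorem EquivariantMatroid.contract_eq_pullback (X : EquivariantMatroid W α) (F : X.Flat)
    (hF : F.1 = ∅) : X.contract F = X.pullback (X.stab F).subtype :=
  EquivariantMatroid.ext' (by
    change X.M ／ F.1 = X.M
    rw [hF, contract_empty_eq]) rfl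

theorem rank_eq_zero_iff (X : EquivariantMatroid W α) : X.rank = 0 ↔ X.M.E = ∅ :=
  rk_eq_zero_iff X.finite X.loopless

theorem exists_isRepChoice (X : EquivariantMatroid W α) :
    ∃ rep : X.FlatOrbit → X.Flat, X.IsRepChoice rep :=
  ⟨Quotient.out, Quotient.out_eq⟩

/-- The values of the equivariant Kazhdan–Lusztig polynomial are the Kazhdan–Lusztig polynomials
of the lattices of fixed flats. -/
theorem exists_ev_eq_kl [Finite W] (X : EquivariantMatroid W α) :
    ∃ p : (VRep W)[X], ∀ w, ev w p = kl X.M (X.act w) := by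
  classical
  induction hn : X.M.E.ncard using Nat.strong_induction_on generalizing W with
  | _ n ih =>
  subst hn
  by_cases hE : X.M.E = ∅
  · exact ⟨1, fun w => by rw [map_one, kl_of_empty hE]⟩
  -- The empty flat gets the value `0`, as it is left out of `klSum`.
  have h1 : ∀ F : X.Flat, ∃ p : (VRep (X.stab F))[X], ∀ v : X.stab F,
      ev v p = if F.1 = ∅ then 0 else cp (X.M ↾ F.1) (X.act v) * kl (X.M ／ F.1) (X.act v) := by
    intro F
    by_cases hF : F.1 = ∅
    · exact ⟨0, fun v => by rw [map_zero, if_pos hF]⟩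
    -- The identity of `W` fixes every flat, so `F` is a fixed flat for it.
    · have hlt := ncard_contract_lt ((X.mem_fixedFlats_iff 1 F).2 (one_smul W F)) hF
      obtain ⟨p, hp⟩ := ih _ hlt (X.contract F) rfl
      refine ⟨(X.localize F).charPoly * p, fun v => ?_⟩
      rw [map_mul, (X.localize F).ev_charPoly, hp, if_neg hF]
      rfl
  choose f hf using h1
  obtain ⟨rep, hrep⟩ := exists_isRepChoice X
  -- The formula defining `kl`, carried out with coefficients in `VRep W`: induction and truncation
  -- stay within virtual characters.
  refine ⟨-lowPart X.rank (∑ o : X.FlatOrbit, indPoly (X.stab (rep o)) (f (rep o))), fun w => ?_⟩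
  rw [map_neg, ev_lowPart, X.ev_sum_indPoly hrep f (fun F w => if F = ∅ then 0 else
    cp (X.M ↾ F) (X.act w) * kl (X.M ／ F) (X.act w)) hf, kl_of_ne_empty hE, klSum,
    X.rank_eq_rk]
  · congr 2
    rw [← Finset.filter_ne', Finset.sum_filter]
    refine Finset.sum_congr rfl fun F _ => ?_
    rw [ite_not]
  · intro F g w
    simp only [Set.image_eq_empty, X.cp_image, X.kl_image]

theorem IsEquivariantKL.ev_eq_kl {P : Assignment.{u, v}} (hP : IsEquivariantKL P) [Finite W]
    (X : EquivariantMatroid W α) (w : W) : ev w (P W α X) = kl X.M (X.act w) := by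
  classical
  induction hn : X.M.E.ncard using Nat.strong_induction_on generalizing W with
  | _ n ih =>
  subst hn
  by_cases hE : X.M.E = ∅
  · rw [hP.rank_zero W α X ((rank_eq_zero_iff X).2 hE), map_one, kl_of_empty hE]
  obtain ⟨rep, hrep⟩ := exists_isRepChoice X
  have hr : X.rank ≠ 0 := mt (rank_eq_zero_iff X).1 hE
  have hd := hP.degree_lt W α X (Nat.pos_of_ne_zero hr)
  have h1 := congrArg (ev w) (hP.recursion W α X rep hrep)
  rw [ev_reflect, X.ev_sum_indPoly hrep
    (fun F => (X.localize F).charPoly * P (X.stab F) α (X.contract F))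
    -- The value at the empty flat is the unknown itself, which gives the equation the shape
    -- required by `eq_kl_of_reflect`.
    (fun F w => if F = ∅ then ev w (P W α X) else
      cp (X.M ↾ F) (X.act w) * kl (X.M ／ F) (X.act w))] at h1
  · refine eq_kl_of_reflect hE ?_ ?_
    · have : (ev w (P W α X)).natDegree ≤ (P W α X).natDegree := natDegree_map_le
      rw [← X.rank_eq_rk]
      omega
    · rw [← X.rank_eq_rk, h1, klSum, ← Finset.add_sum_erase _ _ (X.isAut w).empty_mem, if_pos rfl]
      congr 1
      exact Finset.sum_congr rfl fun F hF => if_neg (Finset.ne_of_mem_erase hF)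
  · intro F v
    rw [map_mul, (X.localize F).ev_charPoly]
    split_ifs with hF
    · rw [X.contract_eq_pullback F hF, hP.pullback, ev_map_res,
        cp_of_empty ((X.localize F).isAut v) hF, one_mul]
      rfl
    · have hlt := ncard_contract_lt ((X.mem_fixedFlats_iff 1 F).2 (one_smul W F)) hF
      rw [ih _ hlt (X.contract F) v rfl]
      rfl
  · intro F g w
    simp only [Set.image_eq_empty, X.cp_image, X.kl_image, ev_conj]

/-- The equivariant Kazhdan–Lusztig polynomial. -/
def equivariantKL : Assignment.{u, v} := fun _ _ _ _ X => (exists_ev_eq_kl X).choose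

theorem ev_equivariantKL [Finite W] (X : EquivariantMatroid W α) (w : W) :
    ev w (equivariantKL W α X) = kl X.M (X.act w) := (exists_ev_eq_kl X).choose_spec w

theorem isEquivariantKL_equivariantKL : IsEquivariantKL equivariantKL.{u, v} where
  rank_zero W _ _ α X h := ev_ext fun w => by
    rw [ev_equivariantKL, map_one, kl_of_empty ((rank_eq_zero_iff X).1 h)]
  degree_lt W _ _ α X h := by
    by_contra hd
    push Not at hd
    -- If the degree were too large, the leading coefficient would vanish at every `w`, by the bound
    -- for `kl`.
    have h1 : (equivariantKL W α X).leadingCoeff = 0 := by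
      refine Subtype.ext (funext fun w => ?_)
      rw [leadingCoeff, ← coeff_ev, ev_equivariantKL]
      exact coeff_kl_eq_zero (mt (rank_eq_zero_iff X).2 h.ne') hd
    rw [leadingCoeff_eq_zero] at h1
    rw [h1, natDegree_zero, mul_zero] at hd
    exact hd.not_gt h
  recursion W _ _ α X rep hrep := ev_ext fun w => by
    rw [ev_reflect, ev_equivariantKL, X.ev_sum_indPoly hrep
      (fun F => (X.localize F).charPoly * equivariantKL (X.stab F) α (X.contract F))
      (fun F w => cp (X.M ↾ F) (X.act w) * kl (X.M ／ F) (X.act w)), X.rank_eq_rk,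
      reflect_kl (X.isAut w)]
    · intro F v
      rw [map_mul, (X.localize F).ev_charPoly, ev_equivariantKL]
      rfl
    · intro F g w
      rw [X.cp_image, X.kl_image]
  pullback W W' _ _ _ _ φ α X := ev_ext fun w => by
    rw [ev_map_res, ev_equivariantKL, ev_equivariantKL]
    rfl

theorem coeff_cp_eq_neg_osTrace (X : EquivariantMatroid W α) (hr : X.rank ≠ 0) (w : W) :
    (cp X.M (X.act w)).coeff (X.rank - 1) = -X.osTrace 1 w := by
  rw [← X.ev_charPoly, X.ev_charPoly_eq_sum, finsetSum_coeff,
    Finset.sum_eq_single_of_mem 1 (Finset.mem_range.2 (by omega))]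
  · rw [coeff_C_mul_X_pow, if_pos rfl, pow_one, neg_one_mul]
  · intro p hp hne
    rw [Finset.mem_range] at hp
    rw [coeff_C_mul_X_pow, if_neg (by omega)]

end Main

end EquivariantKL

end

theorem corollary2p8 :
    (∃! P : EquivariantKL.Assignment.{u, v}, EquivariantKL.IsEquivariantKL P) ∧
    ∀ P : EquivariantKL.Assignment.{u, v}, EquivariantKL.IsEquivariantKL P →
      ∀ (W : Type u) [Group W] [Finite W] (α : Type v)
        (X : EquivariantKL.EquivariantMatroid W α),
        (P W α X).coeff 0 = 1 ∧
        ∀ rep : X.FlatOrbit → X.Flat, X.IsRepChoice rep →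
          (P W α X).coeff 1 =
            (∑ o : X.FlatOrbit with X.flatRank (rep o) + 1 = X.rank,
              EquivariantKL.ind (X.stab (rep o)) 1) - X.osClass 1 := by
  open EquivariantKL in
  refine ⟨⟨equivariantKL, isEquivariantKL_equivariantKL, fun P hP => ?_⟩, ?_⟩
  · funext W _ _ α X
    exact ev_ext fun w => by rw [hP.ev_eq_kl, ev_equivariantKL]
  intro P hP W _ _ α X
  constructor
  · refine Subtype.ext (funext fun w => ?_)
    rw [← coeff_ev, hP.ev_eq_kl, coeff_zero_kl (X.isAut w)]
    rfl
  intro rep hrep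
  refine Subtype.ext (funext fun w => ?_)
  have h1 : ((∑ o : X.FlatOrbit with X.flatRank (rep o) + 1 = X.rank,
      ind (X.stab (rep o)) 1 : VRep W) : W → ℂ) w =
      ∑ F ∈ fixedFlats X.M (X.act w), if rk (X.M ↾ F) + 1 = X.rank then (1 : ℂ) else 0 := by
    -- The condition on the corank is moved into the function, since `sum_indFun` runs over all
    -- orbits. At `w`, the sum counts the fixed flats of corank one.
    rw [← X.sum_indFun hrep (fun F _ => if rk (X.M ↾ F.1) + 1 = X.rank then 1 else 0)
      (fun F _ => if rk (X.M ↾ F) + 1 = X.rank then (1 : ℂ) else 0) (fun _ _ => rfl)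
      (fun F g w => by rw [X.rk_restrict_image])]
    rw [AddSubmonoidClass.coe_finsetSum, Finset.sum_apply, Finset.sum_filter]
    refine Finset.sum_congr rfl fun o _ => ?_
    rw [X.flatRank_eq_rk]
    split_ifs
    · rfl
    · exact (congrFun (indFun_zero (X.stab (rep o))) w).symm
  change _ = ((∑ o : X.FlatOrbit with X.flatRank (rep o) + 1 = X.rank,
      ind (X.stab (rep o)) 1 : VRep W) : W → ℂ) w - X.osTrace 1 w
  rw [h1, ← coeff_ev, hP.ev_eq_kl]
  -- In rank `0` the index `rk M - 1` is truncated and the comparison of coefficients fails, but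
  -- there all terms vanish: no flat has corank one, and degree `1` exceeds the rank.
  by_cases hE : X.M.E = ∅
  · have hr := (rank_eq_zero_iff X).2 hE
    rw [kl_of_empty hE, X.osTrace_eq_zero (by omega), Polynomial.coeff_one, if_neg one_ne_zero,
      Finset.sum_eq_zero, sub_zero]
    intro F _
    rw [if_neg (by omega)]
  · rw [coeff_one_kl (X.isAut w) hE, ← X.rank_eq_rk,
      coeff_cp_eq_neg_osTrace X (mt (rank_eq_zero_iff X).1 hE), ← sub_eq_add_neg]
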